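/- Let $k$ be a commutative ring and let $\mathcal C$ be a small $k$-linear category. For objects $c,d$ write ${}_d\mathcal C_c=\mathrm{Hom}_{\mathcal C}(c,d)$; by composition it is a left module over the ring ${}_d\mathcal C_d=\mathrm{End}(d)$ and a right module over ${}_c\mathcal C_c=\mathrm{End}(c)$. Let $\mathrm{Mod}\,\mathcal C$ be the category of $k$-linear functors $\mathcal C^{\mathrm{op}}\to\mathrm{Mod}\,k$. The boundary $\partial\mathcal C=\coprod_c {}_c\mathcal C_c$ is the $k$-linear category with the same objects as $\mathcal C$, with $\partial\mathcal C(c,c)={}_c\mathcal C_c$ and with $\partial\mathcal C(c,d)=0$ for $c\neq d$. A Gorenstein category is a Grothendieck category $\mathcal A$ such that (i) an object has finite projective dimension if and only if it has finite injective dimension; (ii) the finitary projective dimension (the supremum of all finite projective dimensions of objects) and the finitary injective dimension (defined dually) are finite; (iii) $\mathcal A$ has a generator of finite projective dimension. Its Gorenstein dimension is the common value $n\in\mathbb N$ of its finitary projective and finitary injective dimensions. A small $k$-linear category $\mathcal D$ is called Gorenstein, of Gorenstein dimension $n$, if $\mathrm{Mod}\,\mathcal D$ is so. An object of an abelian category is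 Gorenstein projective if it is the object of $0$-cocycles of an acyclic unbounded complex of projectives which stays acyclic under $\mathrm{Hom}(-,Q)$ for every projective $Q$. Theorem. Suppose that: 1. $\partial\mathcal C$ is Gorenstein. 2. $\mathcal C$ is locally bounded: for every object $c$, the full subcategories $\mathrm{in}(c)=\{d : {}_c\mathcal C_d\neq 0\}$ and $\mathrm{out}(c)=\{d : {}_d\mathcal C_c\neq 0\}$ have only finitely many objects. 3. There is a $k$-linear automorphism $S$ of the category $\mathcal C$ which restricts to an isomorphism $\mathrm{in}(c)\to\mathrm{out}(c)$ for every object $c$. 4. For all objects $c,d$ there is an isomorphism of left ${}_d\mathcal C_d$-modules $$\psi_{c,d}\colon {}_d\mathcal C_c\;\cong\;\mathrm{Hom}_{{}_d\mathcal C_d}({}_{Sc}\mathcal C_d,\,{}_d\mathcal C_d)$$ (homomorphisms of right ${}_d\mathcal C_d$-modules), natural in $c\in\mathcal C$. 5. For all objects $c,d$, the right ${}_c\mathcal C_c$-module ${}_d\mathcal C_c$ is finitely generated and Gorenstein projective. Then $\mathcal C$ is Gorenstein, of the same Gorenstein dimension as $\partial\mathcal C$. -/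

import Mathlib

open CategoryTheory CategoryTheory.Limits ZeroObject

universe u v w

namespace GorensteinCat

noncomputable section

/-! ### Gorenstein abelian categories -/

section AbelianCategories

variable (A : Type v) [Category.{w} A] [Abelian A]

/-- The finitary projective dimension: the supremum of the projective dimensions of all objects of
finite projective dimension (the zero object, of dimension `⊥`, contributes `0`). -/
def finitaryProjectiveDimension : ℕ∞ :=
  ⨆ (M : A) (_ : projectiveDimension M < ⊤), (projectiveDimension M).unbotD 0

/-- The finitary injective dimension: the supremum of the injective dimensions of all objects of
finite injective dimension (the zero object, of dimension `⊥`, contributes `0`). -/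
def finitaryInjectiveDimension : ℕ∞ :=
  ⨆ (M : A) (_ : injectiveDimension M < ⊤), (injectiveDimension M).unbotD 0

/-- Gorenstein categories: Grothendieck categories in which the objects of finite projective
dimension and those of finite injective dimension coincide, whose finitary projective and injective
dimensions are finite, and which have a generator of finite projective dimension. -/
structure IsGorensteinCategory : Prop where
  isGrothendieckAbelian : IsGrothendieckAbelian.{w} A
  projectiveDimension_lt_top_iff (M : A) :
    projectiveDimension M < ⊤ ↔ injectiveDimension M < ⊤
  finitaryProjectiveDimension_lt_top : finitaryProjectiveDimension A < ⊤
  finitaryInjectiveDimension_lt_top : finitaryInjectiveDimension A < ⊤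
  exists_generator : ∃ G : A, IsSeparator G ∧ projectiveDimension G < ⊤

/-- `A` is Gorenstein of Gorenstein dimension exactly `n`. The Gorenstein dimension is the common
value of the finitary projective and of the finitary injective dimension. -/
structure IsGorensteinCategoryOfDim (n : ℕ) : Prop extends IsGorensteinCategory A where
  finitaryProjectiveDimension_eq : finitaryProjectiveDimension A = n
  finitaryInjectiveDimension_eq : finitaryInjectiveDimension A = n

variable {A}

/-- A complete projective resolution: an acyclic (unbounded) complex of projective objects which
stays acyclic under `Hom(-, Q)` for every projective object `Q`. -/
structure IsCompleteProjectiveResolution (P : CochainComplex A ℤ) : Prop where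
  projective (n : ℤ) : Projective (P.X n)
  acyclic : P.Acyclic
  hom_acyclic (Q : A) [Projective Q] (n : ℤ) (f : P.X n ⟶ Q) (hf : P.d (n - 1) n ≫ f = 0) :
    ∃ g : P.X (n + 1) ⟶ Q, P.d n (n + 1) ≫ g = f

/-- Gorenstein projective objects: the objects of cocycles of complete projective resolutions. -/
def IsGorensteinProjective (M : A) : Prop :=
  ∃ P : CochainComplex A ℤ, IsCompleteProjectiveResolution P ∧ Nonempty (M ≅ P.cycles 0)

end AbelianCategories

/-! ### Modules over a small `k`-linear category -/

section Modules

variable (k : Type u) [CommRing k]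

/-- The opposite of a `k`-linear category is `k`-linear. -/
instance linearOpposite (C : Type v) [Category.{w} C] [Preadditive C] [Linear k C] :
    Linear k Cᵒᵖ where
  homModule X Y :=
    { smul := fun r f => (r • f.unop).op
      one_smul := fun f => Quiver.Hom.unop_inj (one_smul k f.unop)
      mul_smul := fun r s f => Quiver.Hom.unop_inj (mul_smul r s f.unop)
      smul_zero := fun r => Quiver.Hom.unop_inj (smul_zero (A := Y.unop ⟶ X.unop) r)
      smul_add := fun r f g => Quiver.Hom.unop_inj (smul_add r f.unop g.unop)
      add_smul := fun r s f => Quiver.Hom.unop_inj (add_smul r s f.unop)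
      zero_smul := fun f => Quiver.Hom.unop_inj (zero_smul k f.unop) }
  smul_comp _ _ _ r f g := Quiver.Hom.unop_inj (Linear.comp_smul _ _ _ g.unop r f.unop)
  comp_smul _ _ _ f r g := Quiver.Hom.unop_inj (Linear.smul_comp _ _ _ r g.unop f.unop)

variable (C : Type u) [Category.{u} C] [Preadditive C] [Linear k C]

/-- The `k`-linear functors `Cᵒᵖ ⥤ Mod k`. -/
def isLinearFunctor : ObjectProperty (Cᵒᵖ ⥤ ModuleCat.{u} k) :=
  fun F => F.Additive ∧ F.Linear k

/-- The category `Mod C` of right `C`-modules: `k`-linear functors `Cᵒᵖ ⥤ Mod k` and all natural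
transformations between them. -/
abbrev RightMod : Type (u + 1) := (isLinearFunctor k C).FullSubcategory

instance : (isLinearFunctor k C).IsClosedUnderSubobjects where
  prop_of_mono {F G} i _ hG := by
    obtain ⟨_, _⟩ := hG
    refine ⟨⟨fun {X Y f g} => ?_⟩, ⟨fun {X Y} f r => ?_⟩⟩
    · rw [← cancel_mono (i.app Y)]
      simp [Functor.map_add]
    · rw [← cancel_mono (i.app Y)]
      simp [Functor.map_smul]

instance : (isLinearFunctor k C).IsClosedUnderQuotients where
  prop_of_epi {F G} p _ hF := by
    obtain ⟨_, _⟩ := hF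
    refine ⟨⟨fun {X Y f g} => ?_⟩, ⟨fun {X Y} f r => ?_⟩⟩
    · rw [← cancel_epi (p.app X)]
      simp [← NatTrans.naturality, Functor.map_add]
    · rw [← cancel_epi (p.app X)]
      simp [← NatTrans.naturality, Functor.map_smul]

instance : (isLinearFunctor k C).IsClosedUnderFiniteProducts where
  isClosedUnderLimitsOfShape J _ :=
    { limitsOfShape_le := by
        rintro F ⟨p⟩
        have hp (j) := p.prop_diag_obj j
        have ext {X Y : Cᵒᵖ} {a b : F.obj X ⟶ F.obj Y}
            (h : ∀ j, a ≫ (p.π.app j).app Y = b ≫ (p.π.app j).app Y) : a = b :=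
          (isLimitOfPreserves ((evaluation _ _).obj Y) p.isLimit).hom_ext h
        refine ⟨⟨fun {X Y f g} => ext fun j => ?_⟩, ⟨fun {X Y} f r => ext fun j => ?_⟩⟩
        · obtain ⟨_, _⟩ := hp j
          have h1 := (p.π.app j).naturality f
          have h2 := (p.π.app j).naturality g
          have h3 := (p.π.app j).naturality (f + g)
          rw [Preadditive.add_comp]
          erw [h1, h2, h3]
          rw [Functor.map_add, Preadditive.comp_add]
        · obtain ⟨_, _⟩ := hp j
          have h1 := (p.π.app j).naturality f
          have h3 := (p.π.app j).naturality (r • f)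
          rw [Linear.smul_comp]
          erw [h1, h3]
          rw [Functor.map_smul, Linear.comp_smul] }

instance : (isLinearFunctor k C).ContainsZero where
  exists_zero := by
    refine ⟨0, isZero_zero _, ⟨fun {X Y f g} => ?_⟩, ⟨fun {X Y} f r => ?_⟩⟩ <;>
    exact ((Functor.isZero_iff _).1 (isZero_zero (Cᵒᵖ ⥤ ModuleCat.{u} k)) X).eq_of_src _ _

instance : Abelian (RightMod k C) := inferInstance

end Modules

/-! ### The boundary -/

section Boundary

/-- The objects of the boundary `∂C` of a preadditive category `C`: those of `C`. -/
structure Boundary (C : Type u) where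
  obj : C

variable {C : Type u} [Category.{u} C] [Preadditive C]

/-- The morphisms of the boundary: all endomorphisms of every object, and only the zero morphism
between distinct objects. -/
def boundaryHom (c d : C) : AddSubgroup (c ⟶ d) where
  carrier := {f | c ≠ d → f = 0}
  add_mem' hf hg h := by rw [hf h, hg h, add_zero]
  zero_mem' _ := rfl
  neg_mem' hf h := by rw [hf h, neg_zero]

/-- The boundary `∂C`: the coproduct of the endomorphism rings of all objects of `C`, in the world
of preadditive categories. -/
instance boundaryCategory : Category.{u} (Boundary C) where
  Hom X Y := boundaryHom X.obj Y.obj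
  id X := ⟨𝟙 X.obj, fun h => (h rfl).elim⟩
  comp {X Y Z} f g := ⟨f.1 ≫ g.1, fun h => by
    by_cases hXY : X.obj = Y.obj
    · rw [g.2 (fun hYZ => h (hXY.trans hYZ)), comp_zero]
    · rw [f.2 hXY, zero_comp]⟩
  id_comp f := Subtype.ext (Category.id_comp f.1)
  comp_id f := Subtype.ext (Category.comp_id f.1)
  assoc f g h := Subtype.ext (Category.assoc f.1 g.1 h.1)

instance boundaryPreadditive : Preadditive (Boundary C) where
  homGroup X Y := inferInstanceAs (AddCommGroup (boundaryHom X.obj Y.obj))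
  add_comp _ _ _ f f' g := Subtype.ext (Preadditive.add_comp _ _ _ f.1 f'.1 g.1)
  comp_add _ _ _ f g g' := Subtype.ext (Preadditive.comp_add _ _ _ f.1 g.1 g'.1)

/-- If `C` is `k`-linear, then so is its boundary. -/
instance boundaryLinear (k : Type u) [CommRing k] [Linear k C] : Linear k (Boundary C) where
  homModule X Y :=
    { smul := fun r f => ⟨r • f.1, fun h => by rw [f.2 h, smul_zero]⟩
      one_smul := fun f => Subtype.ext (one_smul k f.1)
      mul_smul := fun r s f => Subtype.ext (mul_smul r s f.1)
      smul_zero := fun r => Subtype.ext (smul_zero (A := X.obj ⟶ Y.obj) r)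
      smul_add := fun r f g => Subtype.ext (smul_add r f.1 g.1)
      add_smul := fun r s f => Subtype.ext (add_smul r s f.1)
      zero_smul := fun f => Subtype.ext (zero_smul k f.1) }
  smul_comp _ _ _ r f g := Subtype.ext (Linear.smul_comp _ _ _ r f.1 g.1)
  comp_smul _ _ _ f r g := Subtype.ext (Linear.comp_smul _ _ _ f.1 r g.1)

end Boundary

/-! ### Neighbourhoods and automorphisms -/

section Neighbourhoods

variable {C : Type u} [Category.{u} C]

section

variable [Preadditive C]

/-- The objects of the incoming neighbourhood of `c`: those with a nonzero morphism to `c`. -/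
def incoming (c : C) : Set C := {d | ∃ f : d ⟶ c, f ≠ 0}

/-- The objects of the outgoing neighbourhood of `c`: those with a nonzero morphism from `c`. -/
def outgoing (c : C) : Set C := {d | ∃ f : c ⟶ d, f ≠ 0}

variable (C) in
/-- `C` is locally bounded if all neighbourhoods have only finitely many objects. -/
def IsLocallyBounded : Prop :=
  ∀ c : C, (incoming c).Finite ∧ (outgoing c).Finite

end

/-- `S` is an automorphism of the category `C`, i.e. it has a strict two-sided inverse functor. -/
def IsAutomorphism (S : C ⥤ C) : Prop :=
  ∃ T : C ⥤ C, S ⋙ T = 𝟭 C ∧ T ⋙ S = 𝟭 C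

end Neighbourhoods

/-! ### The duality isomorphisms -/

section Duality

variable {C : Type u} [Category.{u} C] [Preadditive C]

/-- A family of isomorphisms `ψ_{c,d} : Hom(c, d) ≅ Hom_{End d}(Hom(d, S c), End d)` of left
`End d`-modules, natural in `c`. Here `End d` acts on `Hom(c, d)` from the left and on
`Hom(d, S c)` from the right by composition, `Hom_{End d}` denotes the maps of right
`End d`-modules, and `End d` acts on them from the left through their values. -/
structure BoundaryDuality (S : C ⥤ C) where
  ψ (c d : C) : (c ⟶ d) ≃ₗ[End d] ((d ⟶ S.obj c) →ₗ[(End d)ᵐᵒᵖ] End d)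
  natural {c c' : C} (d : C) (a : c' ⟶ c) (f : c ⟶ d) (g : d ⟶ S.obj c') :
    ψ c' d (a ≫ f) g = ψ c d f (g ≫ S.map a)

end Duality

end

end GorensteinCat

/-!
Write `∂C` for the boundary and `L : Mod C ⥤ Mod ∂C` for the restriction of modules. Its right
adjoint is coinduction, `N ↦ Hom (L C(-, c), N)` in the variable `c`. Let `R` be coinduction
followed by the autoequivalence of `Mod C` given by restriction along `S`, so that `R N` has the
value `Hom (L C(-, S c), N)` at `c`. The functor `R` is right adjoint to an exact and faithful
functor `L'`, which is `L` up to the inverse autoequivalence. The proof moves homological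
information through this adjunction.

* The modules `C(d, c)` over `End d` are Gorenstein projective, so the functors `Hom (C(d, c), -)`
  are exact on modules of finite projective dimension (`IsGorensteinProjective.exists_lift`). A
  `∂C`-module is just a family of `End d`-modules (`fiber`, `ofFibers`), hence `R` is exact on the
  `∂C`-modules of finite projective dimension (`epi_coind_map`). These are also the `∂C`-modules
  of finite injective dimension, as `∂C` is Gorenstein.
* By the duality isomorphisms, `R` sends the free module `∂C(-, d)` to `C(-, d)`
  (`nonempty_rep_iso`). The modules `L C(-, c)` are finitely generated, because neighbourhoods are
  finite and the modules `C(d, c)` are finitely generated. So `R` preserves coproducts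
  (`RightMod.preservesCoproduct_coind`), it preserves projective modules, and every projective
  `C`-module is a retract of `R Q` for a projective `∂C`-module `Q`.

The conclusion is now formal (`exists_isGorensteinCategoryOfDim_of_adjunction`). Let `n` be the
Gorenstein dimension of `∂C`. As a right adjoint of an exact functor, `R` preserves injective
objects, so it maps finite projective and finite injective resolutions to such resolutions.
Projective `C`-modules are retracts of modules `R Q` with `Q` projective, so they have injective
dimension at most `n`. An injective `C`-module `I` is a retract of `R J` for an injective `J`
containing `L' I`, so it has projective dimension at most `n`. Dimension shifting then shows that
`Mod C` is Gorenstein of dimension at most `n`. The dimension is not smaller: each `∂C`-module `N`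
is naturally a retract of `L' (R N)` (`coindSection`), so a short exact sequence which splits
under `R` is itself split, and `R` detects finite injective dimensions.
-/

namespace GorensteinCat

open Opposite

/-! ### Dimension shifting -/

section Dimension

variable {A : Type v} [Category.{w} A] [Abelian A]

lemma projectiveDimension_lt_top_iff_exists (M : A) :
    projectiveDimension M < ⊤ ↔ ∃ m, HasProjectiveDimensionLT M m := by
  rw [lt_top_iff_ne_top, projectiveDimension_ne_top_iff]
  exact ⟨fun ⟨n, hn⟩ => ⟨n + 1, hn⟩,
    fun ⟨n, hn⟩ => ⟨n, hasProjectiveDimensionLT_of_ge M n _ (by simp)⟩⟩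

lemma injectiveDimension_lt_top_iff_exists (M : A) :
    injectiveDimension M < ⊤ ↔ ∃ m, HasInjectiveDimensionLT M m := by
  rw [lt_top_iff_ne_top, injectiveDimension_ne_top_iff]
  exact ⟨fun ⟨n, hn⟩ => ⟨n + 1, hn⟩,
    fun ⟨n, hn⟩ => ⟨n, hasInjectiveDimensionLT_of_ge M n _ (by simp)⟩⟩

lemma finitaryProjectiveDimension_le_iff (n : ℕ) :
    finitaryProjectiveDimension A ≤ n ↔
      ∀ (M : A) (m : ℕ), HasProjectiveDimensionLT M m → HasProjectiveDimensionLT M (n + 1) := by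
  simp only [finitaryProjectiveDimension, iSup_le_iff, projectiveDimension_lt_top_iff_exists,
    forall_exists_index, WithBot.unbotD_le_iff (b := (n : ℕ∞)) (fun _ => zero_le)]
  exact forall₃_congr fun M _ _ => projectiveDimension_le_iff M n

lemma finitaryInjectiveDimension_le_iff (n : ℕ) :
    finitaryInjectiveDimension A ≤ n ↔
      ∀ (M : A) (m : ℕ), HasInjectiveDimensionLT M m → HasInjectiveDimensionLT M (n + 1) := by
  simp only [finitaryInjectiveDimension, iSup_le_iff, injectiveDimension_lt_top_iff_exists,
    forall_exists_index, WithBot.unbotD_le_iff (b := (n : ℕ∞)) (fun _ => zero_le)]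
  exact forall₃_congr fun M _ _ => injectiveDimension_le_iff M n

/-- Objects of finite projective dimension are reached from zero and projective objects by taking
cokernels of monomorphisms into projective objects. -/
lemma hasProjectiveDimensionLT_induction [EnoughProjectives A] {motive : ℕ → A → Prop}
    (zero : ∀ M, IsZero M → motive 0 M) (projective : ∀ P, Projective P → motive 1 P)
    (cokernel : ∀ (m : ℕ) (S : ShortComplex A), S.ShortExact → Projective S.X₂ →
      HasProjectiveDimensionLT S.X₁ (m + 1) → HasProjectiveDimensionLT S.X₃ (m + 2) →
      motive (m + 1) S.X₁ → motive (m + 2) S.X₃) (m : ℕ) (M : A)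
    (hM : HasProjectiveDimensionLT M m) : motive m M := by
  induction m generalizing M with
  | zero => exact zero M (isZero_of_hasProjectiveDimensionLT_zero M)
  | succ m ih =>
    cases m with
    | zero => exact projective M (projective_iff_hasProjectiveDimensionLT_one.2 hM)
    | succ m =>
      obtain ⟨p⟩ := EnoughProjectives.presentation M
      have hS : (ShortComplex.mk _ _ (kernel.condition p.f)).ShortExact :=
        { exact := ShortComplex.exact_kernel p.f }
      have h₁ := (hS.hasProjectiveDimensionLT_X₃_iff m p.projective).1 hM
      exact cokernel m _ hS p.projective h₁ hM (ih _ h₁)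

/-- Objects of finite injective dimension are reached from zero and injective objects by taking
kernels of epimorphisms out of injective objects. -/
lemma hasInjectiveDimensionLT_induction [EnoughInjectives A] {motive : ℕ → A → Prop}
    (zero : ∀ M, IsZero M → motive 0 M) (injective : ∀ I, Injective I → motive 1 I)
    (kernel : ∀ (m : ℕ) (S : ShortComplex A), S.ShortExact → Injective S.X₂ →
      HasInjectiveDimensionLT S.X₃ (m + 1) → HasInjectiveDimensionLT S.X₁ (m + 2) →
      motive (m + 1) S.X₃ → motive (m + 2) S.X₁) (m : ℕ) (M : A)
    (hM : HasInjectiveDimensionLT M m) : motive m M := by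
  induction m generalizing M with
  | zero => exact zero M (isZero_of_hasInjectiveDimensionLT_zero M)
  | succ m ih =>
    cases m with
    | zero => exact injective M (injective_iff_hasInjectiveDimensionLT_one.2 hM)
    | succ m =>
      obtain ⟨p⟩ := EnoughInjectives.presentation M
      have hS : (ShortComplex.mk _ _ (cokernel.condition p.f)).ShortExact :=
        { exact := ShortComplex.exact_cokernel p.f }
      have h₁ := (hS.hasInjectiveDimensionLT_X₃_iff m p.injective).2 hM
      exact kernel m _ hS p.injective h₁ hM (ih _ h₁)

/-- If the projective objects have injective dimension at most `n`, then so do all objects of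
finite projective dimension. -/
lemma hasInjectiveDimensionLT_of_hasProjectiveDimensionLT [EnoughProjectives A] {n : ℕ}
    (h : ∀ Q : A, Projective Q → HasInjectiveDimensionLT Q (n + 1)) (M : A) (m : ℕ)
    (hM : HasProjectiveDimensionLT M m) : HasInjectiveDimensionLT M (n + 1) := by
  refine hasProjectiveDimensionLT_induction (motive := fun _ M => HasInjectiveDimensionLT M (n + 1))
    (fun M hM => ?_) h (fun m S hS hP _ _ h₁ => ?_) m M hM
  · have := hM.hasInjectiveDimensionLT_zero
    exact hasInjectiveDimensionLT_of_ge M 0 _ (by simp)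
  · exact hS.hasInjectiveDimensionLT_X₃ _ (h _ hP)
      (hasInjectiveDimensionLT_of_ge _ (n + 1) _ (by simp))

/-- If the injective objects have projective dimension at most `n`, then so do all objects of
finite injective dimension. -/
lemma hasProjectiveDimensionLT_of_hasInjectiveDimensionLT [EnoughInjectives A] {n : ℕ}
    (h : ∀ I : A, Injective I → HasProjectiveDimensionLT I (n + 1)) (M : A) (m : ℕ)
    (hM : HasInjectiveDimensionLT M m) : HasProjectiveDimensionLT M (n + 1) := by
  refine hasInjectiveDimensionLT_induction (motive := fun _ M => HasProjectiveDimensionLT M (n + 1))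
    (fun M hM => ?_) h (fun m S hS hI _ _ h₁ => ?_) m M hM
  · have := hM.hasProjectiveDimensionLT_zero
    exact hasProjectiveDimensionLT_of_ge M 0 _ (by simp)
  · exact hS.hasProjectiveDimensionLT_X₁ _ (h _ hI)
      (hasProjectiveDimensionLT_of_ge _ (n + 1) _ (by simp))

/-- If the projective objects have injective dimension at most `n`, then finite projective
dimensions are at most `n`: in the top degree `m`, the functor `Ext^m(M, -)` is right exact, so it
is detected by projective objects. -/
lemma hasProjectiveDimensionLT_of_injectiveDimension_projective [EnoughProjectives A] {n : ℕ}
    (h : ∀ Q : A, Projective Q → HasInjectiveDimensionLT Q (n + 1)) (M : A) (m : ℕ)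
    (hM : HasProjectiveDimensionLT M m) : HasProjectiveDimensionLT M (n + 1) := by
  induction m with
  | zero => exact hasProjectiveDimensionLT_of_ge M 0 _ (by simp)
  | succ m ih =>
    by_cases hm : m ≤ n
    · exact hasProjectiveDimensionLT_of_ge M (m + 1) _ (by lia)
    refine ih ?_
    let := HasExt.standard A
    rw [hasProjectiveDimensionLT_iff]
    intro i hi Y e
    obtain ⟨p⟩ := EnoughProjectives.presentation Y
    have hS : (ShortComplex.mk _ _ (kernel.condition p.f)).ShortExact :=
      { exact := ShortComplex.exact_kernel p.f }
    obtain ⟨x, rfl⟩ := Abelian.Ext.covariant_sequence_exact₃ M hS e rfl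
      (Abelian.Ext.eq_zero_of_hasProjectiveDimensionLT _ (m + 1) (by lia))
    have := h p.p p.projective
    rw [x.eq_zero_of_hasInjectiveDimensionLT (n + 1) (by lia), Abelian.Ext.zero_comp]

/-- If the injective objects have projective dimension at most `n`, then finite injective
dimensions are at most `n`. -/
lemma hasInjectiveDimensionLT_of_projectiveDimension_injective [EnoughInjectives A] {n : ℕ}
    (h : ∀ I : A, Injective I → HasProjectiveDimensionLT I (n + 1)) (M : A) (m : ℕ)
    (hM : HasInjectiveDimensionLT M m) : HasInjectiveDimensionLT M (n + 1) := by
  induction m with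
  | zero => exact hasInjectiveDimensionLT_of_ge M 0 _ (by simp)
  | succ m ih =>
    by_cases hm : m ≤ n
    · exact hasInjectiveDimensionLT_of_ge M (m + 1) _ (by lia)
    refine ih ?_
    let := HasExt.standard A
    rw [hasInjectiveDimensionLT_iff]
    intro i hi Y e
    obtain ⟨p⟩ := EnoughInjectives.presentation Y
    have hS : (ShortComplex.mk _ _ (cokernel.condition p.f)).ShortExact :=
      { exact := ShortComplex.exact_cokernel p.f }
    obtain ⟨x, rfl⟩ := Abelian.Ext.contravariant_sequence_exact₁ hS M e rfl
      (Abelian.Ext.eq_zero_of_hasInjectiveDimensionLT _ (m + 1) (by lia))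
    have := h p.J p.injective
    rw [x.eq_zero_of_hasProjectiveDimensionLT (n + 1) (by lia), Abelian.Ext.comp_zero]

/-- The finitary projective and injective dimensions of a Gorenstein category agree: the first one
is the supremum of the injective dimensions of the projective objects, the second one is the
supremum of the projective dimensions of the injective objects. -/
lemma IsGorensteinCategory.finitaryDimension_eq [EnoughProjectives A]
    (hA : IsGorensteinCategory A) :
    finitaryProjectiveDimension A = finitaryInjectiveDimension A := by
  have := hA.isGrothendieckAbelian
  obtain ⟨a, ha⟩ := ENat.ne_top_iff_exists.1 hA.finitaryProjectiveDimension_lt_top.ne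
  obtain ⟨b, hb⟩ := ENat.ne_top_iff_exists.1 hA.finitaryInjectiveDimension_lt_top.ne
  have hP := (finitaryProjectiveDimension_le_iff (A := A) a).1 ha.ge
  have hI := (finitaryInjectiveDimension_le_iff (A := A) b).1 hb.ge
  have hfin (M : A) : (∃ m, HasProjectiveDimensionLT M m) ↔ ∃ m, HasInjectiveDimensionLT M m := by
    simpa only [projectiveDimension_lt_top_iff_exists, injectiveDimension_lt_top_iff_exists]
      using hA.projectiveDimension_lt_top_iff M
  refine le_antisymm ?_ ?_
  · rw [← hb, finitaryProjectiveDimension_le_iff]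
    refine hasProjectiveDimensionLT_of_injectiveDimension_projective fun Q _ => ?_
    obtain ⟨m, hm⟩ := (hfin Q).1 ⟨1, inferInstance⟩
    exact hI Q m hm
  · rw [← ha, finitaryInjectiveDimension_le_iff]
    refine hasInjectiveDimensionLT_of_projectiveDimension_injective fun I _ => ?_
    obtain ⟨m, hm⟩ := (hfin I).2 ⟨1, inferInstance⟩
    exact hP I m hm

end Dimension

/-! ### Transfer of the Gorenstein property along an adjunction -/

section Transfer

variable {A B : Type v} [Category.{w} A] [Category.{w} B] [Abelian A] [Abelian B]
  {L : A ⥤ B} {R : B ⥤ A}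

lemma shortExact_map_of_epi (adj : L ⊣ R) {S : ShortComplex B} (hS : S.ShortExact)
    [R.PreservesZeroMorphisms] (hepi : Epi (R.map S.g)) : (S.map R).ShortExact := by
  have := adj.rightAdjoint_preservesLimits
  have := hS.mono_f
  have : Mono (S.map R).f := inferInstanceAs (Mono (R.map S.f))
  have : Epi (S.map R).g := hepi
  exact { exact := hS.exact.map_of_mono_of_preservesKernel R inferInstance inferInstance }

/-- The functor `R` reflects injectivity of the first term of a short exact sequence with injective
middle term which stays exact under `R`: it becomes split under `R`, hence it is itself split, being
naturally a retract of its image under `R ⋙ L`. -/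
lemma injective_of_injective_map (adj : L ⊣ R)
    (ι : 𝟭 B ⟶ R ⋙ L) (π : R ⋙ L ⟶ 𝟭 B) (hιπ : ι ≫ π = 𝟙 _) (S : ShortComplex B)
    (hS : S.ShortExact) (hI : Injective S.X₂) (hepi : Epi (R.map S.g))
    (h : Injective (R.obj S.X₁)) : Injective S.X₁ := by
  have : R.PreservesZeroMorphisms :=
    have := adj.isRightAdjoint
    inferInstance
  have : Injective (S.map R).X₁ := h
  have hs := (shortExact_map_of_epi adj hS hepi).splittingOfInjective
  have hι (X : B) : ι.app X ≫ π.app X = 𝟙 X := congr_app hιπ X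
  obtain ⟨ρ, h2⟩ : ∃ ρ : R.obj S.X₂ ⟶ R.obj S.X₁, R.map S.f ≫ ρ = 𝟙 _ := ⟨hs.r, hs.f_r⟩
  let r : S.X₂ ⟶ S.X₁ := ι.app S.X₂ ≫ L.map ρ ≫ π.app S.X₁
  have hr : S.f ≫ r = 𝟙 _ := by
    have h1 : S.f ≫ ι.app S.X₂ = ι.app S.X₁ ≫ L.map (R.map S.f) := ι.naturality S.f
    calc S.f ≫ r = ι.app S.X₁ ≫ L.map (R.map S.f ≫ ρ) ≫ π.app S.X₁ := by
          simp only [r, L.map_comp, Category.assoc, reassoc_of% h1]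
      _ = ι.app S.X₁ ≫ π.app S.X₁ := by
          rw [h2, L.map_id]; exact congr_arg (ι.app S.X₁ ≫ ·) (Category.id_comp _)
      _ = 𝟙 _ := hι _
  exact (Retract.mk S.f r hr).injective

/-- The Gorenstein property and the Gorenstein dimension pass from `B` to `A` along an adjunction
`L ⊣ R` with `L` exact and faithful, if `R` is exact on the objects of finite projective dimension,
preserves projective objects, reaches all projective objects up to retracts, and if every object
`N` of `B` is naturally a retract of `L (R N)`. -/
theorem exists_isGorensteinCategoryOfDim_of_adjunction [EnoughProjectives A] [EnoughProjectives B]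
    (adj : L ⊣ R) [L.PreservesMonomorphisms] [L.Faithful]
    (hB : IsGorensteinCategory B)
    (hepi : ∀ {X Y : B} (p : X ⟶ Y) [Epi p] (m : ℕ), HasProjectiveDimensionLT X m →
      HasProjectiveDimensionLT Y m → Epi (R.map p))
    (hproj : ∀ Q : B, Projective Q → Projective (R.obj Q))
    (hretract : ∀ P : A, Projective P → ∃ Q : B, Projective Q ∧ Nonempty (Retract P (R.obj Q)))
    (ι : 𝟭 B ⟶ R ⋙ L) (π : R ⋙ L ⟶ 𝟭 B) (hιπ : ι ≫ π = 𝟙 _)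
    (hA : IsGrothendieckAbelian.{w} A) (hG : ∃ G : A, IsSeparator G ∧ Projective G) :
    ∃ n : ℕ, IsGorensteinCategoryOfDim B n ∧ IsGorensteinCategoryOfDim A n := by
  have := hB.isGrothendieckAbelian
  have : R.PreservesZeroMorphisms :=
    have := adj.isRightAdjoint
    inferInstance
  obtain ⟨n, hn⟩ := ENat.ne_top_iff_exists.1 hB.finitaryInjectiveDimension_lt_top.ne
  have hn' : finitaryProjectiveDimension B = n := hB.finitaryDimension_eq.trans hn.symm
  have hPB := (finitaryProjectiveDimension_le_iff (A := B) n).1 hn'.le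
  have hIB := (finitaryInjectiveDimension_le_iff (A := B) n).1 hn.ge
  have hfin (M : B) : (∃ m, HasProjectiveDimensionLT M m) ↔ ∃ m, HasInjectiveDimensionLT M m := by
    simpa only [projectiveDimension_lt_top_iff_exists, injectiveDimension_lt_top_iff_exists]
      using hB.projectiveDimension_lt_top_iff M
  have hPI {M : B} {m : ℕ} (h : HasProjectiveDimensionLT M m) :
      HasInjectiveDimensionLT M (n + 1) := by
    obtain ⟨l, hl⟩ := (hfin M).1 ⟨m, h⟩
    exact hIB M l hl
  have hIP {M : B} {m : ℕ} (h : HasInjectiveDimensionLT M m) :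
      HasProjectiveDimensionLT M (n + 1) := by
    obtain ⟨l, hl⟩ := (hfin M).2 ⟨m, h⟩
    exact hPB M l hl
  have hR {S : ShortComplex B} (hS : S.ShortExact) {m : ℕ} (h₂ : HasProjectiveDimensionLT S.X₂ m)
      {m' : ℕ} (h₃ : HasProjectiveDimensionLT S.X₃ m') : Epi (R.map S.g) := by
    have := hS.epi_g
    exact hepi S.g (n + 1) (hPB _ _ h₂) (hPB _ _ h₃)
  -- `R` maps finite projective and finite injective resolutions to such resolutions
  have hRP (m : ℕ) (N : B) (hN : HasProjectiveDimensionLT N m) :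
      HasProjectiveDimensionLT (R.obj N) m := by
    refine hasProjectiveDimensionLT_induction
      (motive := fun m N => HasProjectiveDimensionLT (R.obj N) m)
      (fun M hM => (R.map_isZero hM).hasProjectiveDimensionLT_zero)
      (fun P hP => have := hproj P hP; inferInstance) (fun m S hS hP _ h₃ h₁ => ?_) m N hN
    exact ((shortExact_map_of_epi adj hS (hR hS (m := 1) inferInstance h₃)
      ).hasProjectiveDimensionLT_X₃_iff m (hproj _ hP)).2 h₁
  have hRI (m : ℕ) (N : B) (hN : HasInjectiveDimensionLT N m) :
      HasInjectiveDimensionLT (R.obj N) m := by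
    refine hasInjectiveDimensionLT_induction
      (motive := fun m N => HasInjectiveDimensionLT (R.obj N) m)
      (fun M hM => (R.map_isZero hM).hasInjectiveDimensionLT_zero)
      (fun I hI => have := adj.map_injective I hI; inferInstance)
      (fun m S hS hI h₃ _ h₁ => ?_) m N hN
    exact ((shortExact_map_of_epi adj hS (hR hS (hIP (m := 1) inferInstance) (hIP h₃))
      ).hasInjectiveDimensionLT_X₃_iff m (adj.map_injective _ hI)).1 h₁
  have hPA (P : A) (hP : Projective P) : HasInjectiveDimensionLT P (n + 1) := by
    obtain ⟨Q, hQ, ⟨r⟩⟩ := hretract P hP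
    have := hRI (n + 1) Q (hPI (m := 1) inferInstance)
    exact r.hasInjectiveDimensionLT _
  have hIA (I : A) (hI : Injective I) : HasProjectiveDimensionLT I (n + 1) := by
    -- `I` embeds into `R J` with `J` an injective object containing `L I`
    obtain ⟨p⟩ := EnoughInjectives.presentation (L.obj I)
    have := p.injective
    have := hRP (n + 1) p.J (hIP (m := 1) inferInstance)
    let i : I ⟶ R.obj p.J := adj.homEquiv _ _ p.f
    have : Mono i := by
      refine L.mono_of_mono_map ?_
      have h1 : L.map i ≫ adj.counit.app p.J = p.f := by simp [i, Adjunction.homEquiv_unit]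
      have : Mono (L.map i ≫ adj.counit.app p.J) := h1 ▸ inferInstance
      exact mono_of_mono _ (adj.counit.app p.J)
    have r : Retract I (R.obj p.J) :=
      ⟨i, Injective.factorThru (𝟙 I) i, Injective.comp_factorThru _ _⟩
    exact r.hasProjectiveDimensionLT _
  have hPdA := hasProjectiveDimensionLT_of_injectiveDimension_projective hPA
  have hIdA := hasInjectiveDimensionLT_of_projectiveDimension_injective hIA
  have hPdA' := (finitaryProjectiveDimension_le_iff n).2 hPdA
  have hIdA' := (finitaryInjectiveDimension_le_iff n).2 hIdA
  have hGor : IsGorensteinCategory A :=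
    { isGrothendieckAbelian := hA
      projectiveDimension_lt_top_iff M := by
        rw [projectiveDimension_lt_top_iff_exists, injectiveDimension_lt_top_iff_exists]
        exact ⟨fun ⟨m, hm⟩ => ⟨_, hasInjectiveDimensionLT_of_hasProjectiveDimensionLT hPA M m hm⟩,
          fun ⟨m, hm⟩ => ⟨_, hasProjectiveDimensionLT_of_hasInjectiveDimensionLT hIA M m hm⟩⟩
      finitaryProjectiveDimension_lt_top := hPdA'.trans_lt (ENat.natCast_lt_top n)
      finitaryInjectiveDimension_lt_top := hIdA'.trans_lt (ENat.natCast_lt_top n)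
      exists_generator := by
        obtain ⟨G, hG, _⟩ := hG
        exact ⟨G, hG, (projectiveDimension_lt_top_iff_exists G).2 ⟨1, inferInstance⟩⟩ }
  -- finite injective dimensions in `B` are detected by `R`
  have hdetect (N : B) (l : ℕ) (hN : HasInjectiveDimensionLT N l) (m : ℕ)
      (h : HasInjectiveDimensionLT (R.obj N) (m + 1)) : HasInjectiveDimensionLT N (m + 1) := by
    induction m generalizing N l with
    | zero =>
      obtain ⟨p⟩ := EnoughInjectives.presentation N
      have := p.injective
      have hS : (ShortComplex.mk _ _ (cokernel.condition p.f)).ShortExact :=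
        { exact := ShortComplex.exact_cokernel p.f }
      have h₃ := hS.hasInjectiveDimensionLT_X₃ (l + 1) (inferInstanceAs
        (HasInjectiveDimensionLT p.J _)) (hasInjectiveDimensionLT_of_ge N l _ (by lia))
      have : Injective N := injective_of_injective_map adj ι π hιπ _ hS p.injective
        (hR hS (hIP (m := 1) (inferInstanceAs (HasInjectiveDimensionLT p.J 1))) (hIP h₃))
        (inferInstanceAs (Injective (R.obj N)))
      infer_instance
    | succ m ih =>
      obtain ⟨p⟩ := EnoughInjectives.presentation N
      have := p.injective
      have hS : (ShortComplex.mk _ _ (cokernel.condition p.f)).ShortExact :=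
        { exact := ShortComplex.exact_cokernel p.f }
      have h₃ := hS.hasInjectiveDimensionLT_X₃ (l + 1) (inferInstanceAs
        (HasInjectiveDimensionLT p.J _)) (hasInjectiveDimensionLT_of_ge N l _ (by lia))
      have hRS := shortExact_map_of_epi adj hS
        (hR hS (hIP (m := 1) (inferInstanceAs (HasInjectiveDimensionLT p.J 1))) (hIP h₃))
      exact (hS.hasInjectiveDimensionLT_X₃_iff m p.injective).1
        (ih _ _ h₃ ((hRS.hasInjectiveDimensionLT_X₃_iff m
          (adj.map_injective _ p.injective)).2 h))
  have hIdA_eq : finitaryInjectiveDimension A = n := by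
    refine le_antisymm hIdA' ?_
    obtain ⟨m, hm⟩ := ENat.ne_top_iff_exists.1 hGor.finitaryInjectiveDimension_lt_top.ne
    rw [← hm, hn, finitaryInjectiveDimension_le_iff]
    intro N l hN
    exact hdetect N l hN m
      ((finitaryInjectiveDimension_le_iff m).1 hm.ge _ l (hRI l N hN))
  exact ⟨n, ⟨hB, hn', hn.symm⟩, ⟨hGor, hGor.finitaryDimension_eq.trans hIdA_eq, hIdA_eq⟩⟩

end Transfer

/-! ### Gorenstein projective objects and objects of finite projective dimension -/

section GorensteinProjective

variable {A : Type v} [Category.{w} A] [Abelian A]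

/-- A complete projective resolution stays acyclic under `Hom(-, N)` for every object `N` of finite
projective dimension, by induction on this dimension. -/
lemma IsCompleteProjectiveResolution.exists_factorization [EnoughProjectives A]
    {P : CochainComplex A ℤ} (hP : IsCompleteProjectiveResolution P) (m : ℕ) (N : A)
    (hN : HasProjectiveDimensionLT N m) {i j l : ℤ} (hij : i + 1 = j) (hjl : j + 1 = l)
    (f : P.X j ⟶ N) (hf : P.d i j ≫ f = 0) : ∃ g : P.X l ⟶ N, P.d j l ≫ g = f := by
  revert i j l
  refine hasProjectiveDimensionLT_induction (motive := fun _ N => ∀ {i j l : ℤ} (_ : i + 1 = j)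
    (_ : j + 1 = l) (f : P.X j ⟶ N) (_ : P.d i j ≫ f = 0), ∃ g : P.X l ⟶ N, P.d j l ≫ g = f)
    (fun N hN i j l _ _ f _ => ⟨0, hN.eq_of_tgt _ _⟩)
    (fun Q hQ i j l hij hjl f hf => ?_)
    (fun m S hS hQ _ _ ih i j l hij hjl f hf => ?_) m N hN
  · subst hjl
    obtain rfl : i = j - 1 := by lia
    exact hP.hom_acyclic Q j f hf
  · have := hS.epi_g
    have := hS.mono_f
    have := hP.projective j
    obtain ⟨h, hh⟩ := KernelFork.IsLimit.lift' hS.fIsKernel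
      (P.d i j ≫ Projective.factorThru f S.g) (by simp [hf])
    replace hh : h ≫ S.f = P.d i j ≫ Projective.factorThru f S.g := hh
    obtain ⟨e, he⟩ := ih (i := i - 1) (by lia) hij h (by
      rw [← cancel_mono S.f, Category.assoc, hh]
      simp)
    obtain ⟨g, hg⟩ : ∃ g : P.X l ⟶ S.X₂, P.d j l ≫ g = Projective.factorThru f S.g - e ≫ S.f := by
      subst hjl
      obtain rfl : i = j - 1 := by lia
      exact hP.hom_acyclic S.X₂ j _ (by rw [Preadditive.comp_sub, reassoc_of% he, hh, sub_self])
    exact ⟨g ≫ S.g, by simp [reassoc_of% hg]⟩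

/-- Morphisms from a Gorenstein projective object lift along epimorphisms between objects of finite
projective dimension. -/
lemma IsGorensteinProjective.exists_lift [EnoughProjectives A] {G : A}
    (hG : IsGorensteinProjective G) {Y Z : A} (p : Y ⟶ Z) [Epi p] (m : ℕ)
    (hY : HasProjectiveDimensionLT Y m) (hZ : HasProjectiveDimensionLT Z m) (f : G ⟶ Z) :
    ∃ g : G ⟶ Y, g ≫ p = f := by
  obtain ⟨P, hP, ⟨e⟩⟩ := hG
  suffices h : ∀ f : P.cycles 0 ⟶ Z, ∃ g : P.cycles 0 ⟶ Y, g ≫ p = f by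
    obtain ⟨g, hg⟩ := h (e.inv ≫ f)
    exact ⟨e.hom ≫ g, by simp [hg]⟩
  clear f
  intro f
  have hS : (ShortComplex.mk _ _ (kernel.condition p)).ShortExact :=
    { exact := ShortComplex.exact_kernel p }
  have hN : HasProjectiveDimensionLT (kernel p) m :=
    hS.hasProjectiveDimensionLT_X₁ m hY (hasProjectiveDimensionLT_of_ge Z m _ (by simp))
  have hepi : Epi (P.toCycles (-1) 0) := by
    have h : ∀ i : ℤ, (ComplexShape.up ℤ).prev 0 = i → Epi (P.toCycles i 0) := by
      rintro _ rfl
      have := (hP.acyclic 0).epi_toCycles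
      have h1 : P.toCycles _ 0 = (P.sc 0).toCycles := (cancel_mono (P.iCycles 0)).1
        ((P.toCycles_i _ _).trans (P.sc 0).toCycles_i.symm)
      rwa [h1]
    exact h (-1) (by simp)
  have hexact : (ShortComplex.mk (P.d (-2) (-1)) (P.toCycles (-1) 0) (by simp)).Exact := by
    let φ : ShortComplex.mk (P.d (-2) (-1)) (P.toCycles (-1) 0) (by simp) ⟶ P.sc' (-2) (-1) 0 :=
      { τ₁ := 𝟙 _, τ₂ := 𝟙 _, τ₃ := P.iCycles 0
        comm₁₂ := (Category.id_comp _).trans (Category.comp_id _).symm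
        comm₂₃ := (Category.id_comp _).trans (P.toCycles_i _ _).symm }
    have : Epi φ.τ₁ := inferInstanceAs (Epi (𝟙 _))
    have : IsIso φ.τ₂ := inferInstanceAs (IsIso (𝟙 _))
    have : Mono φ.τ₃ := inferInstanceAs (Mono (P.iCycles 0))
    rw [ShortComplex.exact_iff_of_epi_of_isIso_of_mono φ,
      ← P.exactAt_iff' (-2) (-1) 0 (by simp) (by simp)]
    exact hP.acyclic (-1)
  have := hP.projective (-1)
  -- lift to the projective object covering `G`, and correct the lift so that it descends to `G`
  let u : P.X (-1) ⟶ Y := Projective.factorThru (P.toCycles (-1) 0 ≫ f) p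
  have hu : u ≫ p = P.toCycles (-1) 0 ≫ f := by simp [u]
  let v : P.X (-2) ⟶ kernel p := kernel.lift p (P.d (-2) (-1) ≫ u) (by simp [hu])
  obtain ⟨w, hw⟩ := hP.exists_factorization m _ hN (i := -3) (j := -2) (l := -1) (by simp) (by simp)
    v (by rw [← cancel_mono (kernel.ι p)]; simp [v])
  obtain ⟨g, hg⟩ := CokernelCofork.IsColimit.desc' (hexact.gIsCokernel) (u - w ≫ kernel.ι p)
    (by
      change P.d (-2) (-1) ≫ (u - w ≫ kernel.ι p) = 0
      rw [Preadditive.comp_sub, reassoc_of% hw, kernel.lift_ι, sub_self])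
  replace hg : P.toCycles (-1) 0 ≫ g = u - w ≫ kernel.ι p := hg
  exact ⟨g, by rw [← cancel_epi (P.toCycles (-1) 0), reassoc_of% hg]; simp [hu]⟩

end GorensteinProjective

/-- An exact functor which preserves projective objects does not raise projective dimensions. -/
lemma hasProjectiveDimensionLT_obj {A : Type v} [Category.{w} A] [Abelian A] [EnoughProjectives A]
    {B : Type*} [Category* B] [Abelian B] (F : A ⥤ B) [F.PreservesZeroMorphisms]
    (hF : ∀ S : ShortComplex A, S.ShortExact → (S.map F).ShortExact)
    (hproj : ∀ P : A, Projective P → Projective (F.obj P)) (m : ℕ) (N : A)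
    (hN : HasProjectiveDimensionLT N m) : HasProjectiveDimensionLT (F.obj N) m := by
  refine hasProjectiveDimensionLT_induction
    (motive := fun m N => HasProjectiveDimensionLT (F.obj N) m)
    (fun M hM => (F.map_isZero hM).hasProjectiveDimensionLT_zero)
    (fun P hP => have := hproj P hP; inferInstance) (fun m S hS hP _ h₃ h₁ => ?_) m N hN
  exact ((hF S hS).hasProjectiveDimensionLT_X₃_iff m (hproj _ hP)).2 h₁

/-! ### The category of modules over a small linear category -/

section RightModules

variable {k : Type u} [CommRing k] {D : Type u} [Category.{u} D] [Preadditive D] [Linear k D]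

instance (J : Type w) [Category.{v} J] [HasColimitsOfShape J (ModuleCat.{u} k)] :
    (isLinearFunctor k D).IsClosedUnderColimitsOfShape J where
  colimitsOfShape_le := by
    rintro F ⟨p⟩
    have hp (j) := p.prop_diag_obj j
    have ext {X Y : Dᵒᵖ} {a b : F.obj X ⟶ F.obj Y}
        (h : ∀ j, (p.ι.app j).app X ≫ a = (p.ι.app j).app X ≫ b) : a = b :=
      (isColimitOfPreserves ((evaluation _ _).obj X) p.isColimit).hom_ext h
    refine ⟨⟨fun {X Y f g} => ext fun j => ?_⟩, ⟨fun {X Y} f r => ext fun j => ?_⟩⟩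
    · obtain ⟨_, _⟩ := hp j
      have h1 := (p.ι.app j).naturality f
      have h2 := (p.ι.app j).naturality g
      have h3 := (p.ι.app j).naturality (f + g)
      rw [Preadditive.comp_add]
      erw [← h1, ← h2, ← h3]
      rw [Functor.map_add, Preadditive.add_comp]
    · obtain ⟨_, _⟩ := hp j
      have h1 := (p.ι.app j).naturality f
      have h3 := (p.ι.app j).naturality (r • f)
      rw [Linear.comp_smul]
      erw [← h1, ← h3]
      rw [Functor.map_smul, Linear.smul_comp]

instance (J : Type w) [Category.{v} J] [HasLimitsOfShape J (ModuleCat.{u} k)] :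
    (isLinearFunctor k D).IsClosedUnderLimitsOfShape J where
  limitsOfShape_le := by
    rintro F ⟨p⟩
    have hp (j) := p.prop_diag_obj j
    have ext {X Y : Dᵒᵖ} {a b : F.obj X ⟶ F.obj Y}
        (h : ∀ j, a ≫ (p.π.app j).app Y = b ≫ (p.π.app j).app Y) : a = b :=
      (isLimitOfPreserves ((evaluation _ _).obj Y) p.isLimit).hom_ext h
    refine ⟨⟨fun {X Y f g} => ext fun j => ?_⟩, ⟨fun {X Y} f r => ext fun j => ?_⟩⟩
    · obtain ⟨_, _⟩ := hp j
      have h1 := (p.π.app j).naturality f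
      have h2 := (p.π.app j).naturality g
      have h3 := (p.π.app j).naturality (f + g)
      rw [Preadditive.add_comp]
      erw [h1, h2, h3]
      rw [Functor.map_add, Preadditive.comp_add]
    · obtain ⟨_, _⟩ := hp j
      have h1 := (p.π.app j).naturality f
      have h3 := (p.π.app j).naturality (r • f)
      rw [Linear.smul_comp]
      erw [h1, h3]
      rw [Functor.map_smul, Linear.comp_smul]

namespace RightMod

instance (M : RightMod k D) : M.obj.Additive := M.property.1
instance (M : RightMod k D) : M.obj.Linear k := M.property.2

/-- Evaluation of modules at an object. -/
noncomputable abbrev evaluation (k : Type u) [CommRing k] [Linear k D] (X : Dᵒᵖ) :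
    RightMod k D ⥤ ModuleCat.{u} k :=
  (isLinearFunctor k D).ι ⋙ (CategoryTheory.evaluation _ _).obj X

instance (X : Dᵒᵖ) : (evaluation k X).Additive where

instance : HasColimitsOfSize.{u, u} (RightMod k D) where

instance (X : Dᵒᵖ) : PreservesColimitsOfSize.{u, u} (evaluation k X) where

instance : PreservesFiniteLimits (isLinearFunctor k D).ι where
  preservesFiniteLimits _ := inferInstance


@[ext]
lemma hom_ext {M N : RightMod k D} {f g : M ⟶ N}
    (h : ∀ (X : Dᵒᵖ) (x : M.obj.obj X), (f.hom.app X).hom x = (g.hom.app X).hom x) : f = g := by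
  apply ObjectProperty.hom_ext
  ext X x
  exact h X x

lemma naturality {M N : RightMod k D} (f : M ⟶ N) {X Y : Dᵒᵖ} (a : X ⟶ Y) (x : M.obj.obj X) :
    (f.hom.app Y).hom ((M.obj.map a).hom x) = (N.obj.map a).hom ((f.hom.app X).hom x) :=
  congr_arg (fun t => t.hom x) (f.hom.naturality a)

/-- Morphisms of modules from families of linear maps. -/
def homMk {M N : RightMod k D} (φ : ∀ X, M.obj.obj X →ₗ[k] N.obj.obj X)
    (h : ∀ {X Y : Dᵒᵖ} (a : X ⟶ Y) (x : M.obj.obj X),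
      φ Y ((M.obj.map a).hom x) = (N.obj.map a).hom (φ X x)) : M ⟶ N :=
  ObjectProperty.homMk
    { app := fun X => ModuleCat.ofHom (φ X)
      naturality := fun X Y a => by ext x; exact h a x }

lemma epi_iff {M N : RightMod k D} (f : M ⟶ N) :
    Epi f ↔ ∀ X, Function.Surjective (f.hom.app X).hom := by
  constructor
  · intro _ X
    exact (ModuleCat.epi_iff_surjective _).1 (inferInstanceAs (Epi ((evaluation k X).map f)))
  · intro h
    refine (isLinearFunctor k D).ι.epi_of_epi_map ?_
    refine (NatTrans.epi_iff_epi_app _).2 fun X => (ModuleCat.epi_iff_surjective _).2 (h X)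

lemma mono_of_injective {M N : RightMod k D} (f : M ⟶ N)
    (h : ∀ X, Function.Injective (f.hom.app X).hom) : Mono f := by
  refine (isLinearFunctor k D).ι.mono_of_mono_map ?_
  refine (NatTrans.mono_iff_mono_app _).2 fun X => (ModuleCat.mono_iff_injective _).2 (h X)

lemma injective_of_mono {M N : RightMod k D} (f : M ⟶ N) [Mono f] (X : Dᵒᵖ) :
    Function.Injective (f.hom.app X).hom :=
  (ModuleCat.mono_iff_injective _).1 (inferInstanceAs (Mono ((evaluation k X).map f)))

lemma isIso_of_bijective {M N : RightMod k D} (f : M ⟶ N)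
    (h : ∀ X, Function.Bijective (f.hom.app X).hom) : IsIso f := by
  have := mono_of_injective f fun X => (h X).1
  have := (epi_iff f).2 fun X => (h X).2
  exact isIso_of_mono_of_epi f

variable (k) in
/-- The representable module of an object. -/
def rep (d : D) : RightMod k D :=
  ⟨(linearYoneda k D).obj d, inferInstance, ⟨fun {X Y} f r => by
    ext (g : X.unop ⟶ d)
    exact Linear.smul_comp _ _ _ r f.unop g⟩⟩

/-- The morphism from a representable module which corresponds to an element by Yoneda's lemma. -/
def repDesc (M : RightMod k D) {d : D} (x : M.obj.obj (op d)) : rep k d ⟶ M :=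
  homMk (fun X =>
    { toFun := fun f => (M.obj.map (Quiver.Hom.op (X := X.unop) (Y := d) f)).hom x
      map_add' := fun f g => by
        have := M.obj.map_add (f := Quiver.Hom.op (X := X.unop) (Y := d) f) (g := Quiver.Hom.op g)
        exact congr_arg (fun t => t.hom x) this
      map_smul' := fun r f => by
        have := M.obj.map_smul r (Quiver.Hom.op (X := X.unop) (Y := d) f)
        exact congr_arg (fun t => t.hom x) this })
    (fun {X Y} a f => by
      have := M.obj.map_comp (Quiver.Hom.op (X := X.unop) (Y := d) f) a
      exact congr_arg (fun t => t.hom x) this)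

lemma repDesc_app (M : RightMod k D) {d : D} (x : M.obj.obj (op d)) {X : D} (f : X ⟶ d) :
    ((repDesc M x).hom.app (op X)).hom f = (M.obj.map f.op).hom x := rfl

lemma repDesc_id (M : RightMod k D) {d : D} (x : M.obj.obj (op d)) :
    ((repDesc M x).hom.app (op d)).hom (𝟙 d) = x := by
  simp [repDesc_app]

lemma repDesc_comp {M N : RightMod k D} {d : D} (x : M.obj.obj (op d)) (f : M ⟶ N) :
    repDesc M x ≫ f = repDesc N ((f.hom.app (op d)).hom x) := by
  ext X g
  exact naturality f (Quiver.Hom.op (X := X.unop) (Y := d) g) x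

instance (d : D) : Projective (rep k d) where
  factors {M N} f p _ := by
    obtain ⟨x, hx⟩ := (epi_iff p).1 inferInstance (op d) ((f.hom.app (op d)).hom (𝟙 d))
    refine ⟨repDesc M x, ?_⟩
    rw [repDesc_comp, hx]
    ext X g
    have := naturality f (Quiver.Hom.op (X := X.unop) (Y := d) g) (𝟙 d)
    refine this.symm.trans ?_
    exact congr_arg (f.hom.app X).hom (Category.comp_id (X := X.unop) (Y := d) g)

/-- The canonical epimorphism from a coproduct of representable modules onto a given module. -/
noncomputable def freeCover (M : RightMod k D) :
    (∐ fun j : Σ d : D, M.obj.obj (op d) => rep k j.1) ⟶ M :=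
  Sigma.desc fun j => repDesc M j.2

instance (M : RightMod k D) : Epi (freeCover M) := by
  rw [epi_iff]
  intro X x
  let j : Σ d : D, M.obj.obj (op d) := ⟨X.unop, x⟩
  have h := Sigma.ι_desc (fun j : Σ d : D, M.obj.obj (op d) => repDesc M j.2) j
  refine ⟨((Sigma.ι (fun j : Σ d : D, M.obj.obj (op d) => rep k j.1) j).hom.app X).hom (𝟙 X.unop),
    ?_⟩
  exact (congr_arg (fun t => (t.hom.app X).hom (𝟙 X.unop)) h).trans (repDesc_id M (d := X.unop) x)

instance : EnoughProjectives (RightMod k D) where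
  presentation M := ⟨{ p := _, f := freeCover M }⟩

lemma isSeparator_coproduct_rep : IsSeparator (∐ fun d : D => rep k d) := by
  rw [isSeparator_sigma]
  intro M N f g h
  ext X x
  have := h _ ⟨X.unop⟩ (repDesc M x)
  rw [repDesc_comp, repDesc_comp] at this
  have := congr_arg (fun t => (t.hom.app X).hom (𝟙 X.unop)) this
  exact (repDesc_id N (d := X.unop) _).symm.trans (this.trans (repDesc_id N (d := X.unop) _))

theorem isGrothendieckAbelian : IsGrothendieckAbelian.{u} (RightMod k D) where
  ab5OfSize :=
    { ofShape := fun J _ _ => HasExactColimitsOfShape.domain_of_functor J (isLinearFunctor k D).ι }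
  hasSeparator := ⟨_, isSeparator_coproduct_rep⟩

open Classical in
/-- The projection of a coproduct of modules onto the summands indexed by a finite set. -/
noncomputable def finsetProj {J : Type u} (N : J → RightMod k D) (s : Finset J) : ∐ N ⟶ ∐ N :=
  ∑ j ∈ s, Sigma.π N j ≫ Sigma.ι N j

lemma ι_finsetProj {J : Type u} (N : J → RightMod k D) {s : Finset J} {j : J} (hj : j ∈ s) :
    Sigma.ι N j ≫ finsetProj N s = Sigma.ι N j := by
  classical
  rw [finsetProj, Preadditive.comp_sum, Finset.sum_eq_single_of_mem j hj]
  · simp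
  · intro i _ hij
    simp [Sigma.ι_π_of_ne_assoc _ hij.symm]

lemma finsetProj_comp_of_subset {J : Type u} (N : J → RightMod k D) {s t : Finset J} (h : s ⊆ t) :
    finsetProj N s ≫ finsetProj N t = finsetProj N s := by
  nth_rw 1 [finsetProj]
  rw [Preadditive.sum_comp]
  exact Finset.sum_congr rfl fun j hj => by rw [Category.assoc, ι_finsetProj N (h hj)]

lemma finsetProj_app_of_subset {J : Type u} (N : J → RightMod k D) {s t : Finset J} (h : s ⊆ t)
    {X : Dᵒᵖ} {x : (∐ N).obj.obj X} (hx : ((finsetProj N s).hom.app X).hom x = x) :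
    ((finsetProj N t).hom.app X).hom x = x := by
  have := congr_arg (fun f => (f.hom.app X).hom x) (finsetProj_comp_of_subset N h)
  change ((finsetProj N t).hom.app X).hom (((finsetProj N s).hom.app X).hom x) =
    ((finsetProj N s).hom.app X).hom x at this
  rwa [hx] at this

/-- Every element of a coproduct of modules is a finite sum of its components. -/
lemma exists_finsetProj_app_eq {J : Type u} (N : J → RightMod k D) {X : Dᵒᵖ}
    (x : (∐ N).obj.obj X) : ∃ s : Finset J, ((finsetProj N s).hom.app X).hom x = x := by
  classical
  let r (j : J) := LinearMap.range ((Sigma.ι N j).hom.app X).hom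
  have hr : ⨆ j, r j = ⊤ := by
    have h0 : ModuleCat.ofHom (⨆ j, r j).mkQ = 0 := by
      refine Cofan.IsColimit.hom_ext
        (isColimitCofanMkObjOfIsColimit (evaluation k X) _ _ (coproductIsCoproduct N)) _ _
        fun j => ?_
      ext y
      exact (Submodule.Quotient.mk_eq_zero _).2 (Submodule.mem_iSup_of_mem j ⟨y, rfl⟩)
    rw [← Submodule.ker_mkQ (⨆ j, r j), LinearMap.ker_eq_top]
    exact congr_arg ModuleCat.Hom.hom h0
  have hx : x ∈ ⨆ j, r j := hr ▸ Submodule.mem_top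
  refine Submodule.iSup_induction r
    (motive := fun x => ∃ s : Finset J, ((finsetProj N s).hom.app X).hom x = x) hx
    ?_ ⟨∅, map_zero _⟩ ?_
  · rintro j _ ⟨z, rfl⟩
    exact ⟨{j}, congr_arg (fun f => (f.hom.app X).hom z)
      (ι_finsetProj N (Finset.mem_singleton_self j))⟩
  · rintro y z ⟨s, hs⟩ ⟨t, ht⟩
    refine ⟨s ∪ t, ?_⟩
    rw [map_add, finsetProj_app_of_subset N Finset.subset_union_left hs,
      finsetProj_app_of_subset N Finset.subset_union_right ht]

/-- A module is finitely generated if it has a finite set of elements on which all morphisms to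
other modules are determined. -/
def IsFinitelyGenerated (M : RightMod k D) : Prop :=
  ∃ G : Set (Σ X : Dᵒᵖ, M.obj.obj X), G.Finite ∧ ∀ (N : RightMod k D) (f g : M ⟶ N),
    (∀ y ∈ G, (f.hom.app y.1).hom y.2 = (g.hom.app y.1).hom y.2) → f = g

/-- Every morphism from a finitely generated module to a coproduct factors through a finite
subcoproduct. -/
lemma IsFinitelyGenerated.exists_comp_finsetProj_eq {M : RightMod k D} (hM : IsFinitelyGenerated M)
    {J : Type u} (N : J → RightMod k D) (f : M ⟶ ∐ N) : ∃ s : Finset J, f ≫ finsetProj N s = f := by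
  classical
  obtain ⟨G, hG, h⟩ := hM
  choose s hs using fun y : Σ X : Dᵒᵖ, M.obj.obj X =>
    exists_finsetProj_app_eq N ((f.hom.app y.1).hom y.2)
  refine ⟨hG.toFinset.biUnion s, h _ _ _ fun y hy => ?_⟩
  exact finsetProj_app_of_subset N
    (Finset.subset_biUnion_of_mem s (hG.mem_toFinset.2 hy)) (hs y)

/-- Projective modules are retracts of coproducts of representable modules. -/
lemma exists_retract_coproduct_rep (P : RightMod k D) [Projective P] :
    ∃ (J : Type u) (d : J → D), Nonempty (Retract P (∐ fun j => rep k (d j))) :=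
  ⟨_, _, ⟨⟨Projective.factorThru (𝟙 P) (freeCover P), freeCover P, by simp⟩⟩⟩

end RightMod

end RightModules

/-! ### Modules over the boundary -/

section BoundaryModules

variable {k : Type u} [CommRing k] {C : Type u} [Category.{u} C] [Preadditive C] [Linear k C]

namespace Boundary

/-- An endomorphism of an object of `C`, as a morphism of the boundary. -/
def ofEnd {c : C} (f : End c) : (⟨c⟩ : Boundary C) ⟶ ⟨c⟩ := ⟨f, fun h => (h rfl).elim⟩

lemma hom_eq_zero {X Y : Boundary C} (h : X.obj ≠ Y.obj) (f : X ⟶ Y) : f = 0 :=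
  Subtype.ext (f.2 h)

end Boundary

open Boundary

/-- The value at `c` of a module over the boundary is a right module over `End c`. -/
instance fiberModule (M : RightMod k (Boundary C)) (c : C) :
    Module (End c)ᵐᵒᵖ (M.obj.obj (op ⟨c⟩)) where
  smul f x := (M.obj.map (ofEnd f.unop).op).hom x
  one_smul x := congr_arg (fun t => t.hom x) (M.obj.map_id (op ⟨c⟩))
  mul_smul f g x := congr_arg (fun t => t.hom x)
    (M.obj.map_comp (ofEnd g.unop).op (ofEnd f.unop).op)
  smul_zero _ := map_zero _
  smul_add _ x y := map_add _ x y
  add_smul f g x := congr_arg (fun t => t.hom x)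
    (M.obj.map_add (f := (ofEnd f.unop).op) (g := (ofEnd g.unop).op))
  zero_smul x := congr_arg (fun t => t.hom x) (M.obj.map_zero (op ⟨c⟩) (op ⟨c⟩))

variable (k) in
/-- The functor sending a module over the boundary to its value at `c`, a right `End c`-module. -/
def fiber (c : C) : RightMod k (Boundary C) ⥤ ModuleCat.{u} (End c)ᵐᵒᵖ where
  obj M := ModuleCat.of (End c)ᵐᵒᵖ (M.obj.obj (op ⟨c⟩))
  map {M N} f := ModuleCat.ofHom
    { toFun := (f.hom.app (op ⟨c⟩)).hom
      map_add' := map_add _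
      map_smul' := fun a x => RightMod.naturality f (ofEnd a.unop).op x }

/-- On underlying abelian groups, the fiber functor is evaluation. -/
def fiberForgetIso (c : C) : fiber k c ⋙ forget₂ (ModuleCat (End c)ᵐᵒᵖ) AddCommGrpCat ≅
    RightMod.evaluation k (op (⟨c⟩ : Boundary C)) ⋙ forget₂ (ModuleCat k) AddCommGrpCat :=
  Iso.refl _

instance (c : C) (J : Type u) [SmallCategory J] : PreservesColimitsOfShape J (fiber k c) := by
  have : PreservesColimitsOfShape J
      (fiber k c ⋙ forget₂ (ModuleCat (End c)ᵐᵒᵖ) AddCommGrpCat) :=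
    preservesColimitsOfShape_of_natIso (fiberForgetIso c).symm
  exact preservesColimitsOfShape_of_reflects_of_preserves _
    (forget₂ (ModuleCat (End c)ᵐᵒᵖ) AddCommGrpCat)

instance (c : C) : PreservesFiniteColimits (fiber k c) := by
  have : PreservesFiniteColimits
      (fiber k c ⋙ forget₂ (ModuleCat (End c)ᵐᵒᵖ) AddCommGrpCat) :=
    preservesFiniteColimits_of_natIso (fiberForgetIso c).symm
  exact ⟨fun J _ _ => preservesColimitsOfShape_of_reflects_of_preserves _
    (forget₂ (ModuleCat (End c)ᵐᵒᵖ) AddCommGrpCat)⟩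

instance (c : C) : PreservesFiniteLimits (fiber k c) := by
  have : PreservesFiniteLimits
      (fiber k c ⋙ forget₂ (ModuleCat (End c)ᵐᵒᵖ) AddCommGrpCat) :=
    preservesFiniteLimits_of_natIso (fiberForgetIso c).symm
  exact ⟨fun J _ _ => preservesLimitsOfShape_of_reflects_of_preserves _
    (forget₂ (ModuleCat (End c)ᵐᵒᵖ) AddCommGrpCat)⟩

instance (c : C) : (fiber k c).Additive where

lemma subsingleton_rep_of_ne {c : C} {X : Boundary C} (h : c ≠ X.obj) :
    Subsingleton ((RightMod.rep k X).obj.obj (op ⟨c⟩)) :=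
  ⟨fun f g => (hom_eq_zero (X := ⟨c⟩) (Y := X) h f).trans
    (hom_eq_zero (X := ⟨c⟩) (Y := X) h g).symm⟩

instance projective_fiber_rep (c : C) (X : Boundary C) :
    Projective ((fiber k c).obj (RightMod.rep k X)) := by
  by_cases h : c = X.obj
  · obtain ⟨d⟩ := X
    subst h
    refine ⟨fun {M N} f p _ => ?_⟩
    obtain ⟨a, ha⟩ := (ModuleCat.epi_iff_surjective p).1 inferInstance
      (f.hom (ofEnd (𝟙 c)))
    refine ⟨ModuleCat.ofHom
      { toFun := fun v : (⟨c⟩ : Boundary C) ⟶ ⟨c⟩ => MulOpposite.op (α := End c) v.1 • a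
        map_add' := fun v w => add_smul (MulOpposite.op (α := End c) v.1)
          (MulOpposite.op (α := End c) w.1) a
        map_smul' := fun r v => mul_smul r (MulOpposite.op (α := End c) v.1) a }, ?_⟩
    ext (v : (⟨c⟩ : Boundary C) ⟶ ⟨c⟩)
    have h1 : p.hom (MulOpposite.op (α := End c) v.1 • a) =
        MulOpposite.op (α := End c) v.1 • f.hom (ofEnd (𝟙 c)) := by
      rw [← ha]; exact map_smul _ _ _
    refine h1.trans ((map_smul f.hom _ _).symm.trans (congr_arg f.hom ?_))
    exact Category.comp_id (X := (⟨c⟩ : Boundary C)) (Y := ⟨c⟩) v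
  · have := subsingleton_rep_of_ne (k := k) h
    have : Subsingleton ((fiber k c).obj (RightMod.rep k X)) := this
    exact (ModuleCat.isZero_of_subsingleton _).projective

lemma projective_fiber (c : C) (P : RightMod k (Boundary C)) (hP : Projective P) :
    Projective ((fiber k c).obj P) := by
  obtain ⟨J, d, ⟨r⟩⟩ := RightMod.exists_retract_coproduct_rep P
  have : Projective ((fiber k c).obj (∐ fun j => RightMod.rep k (d j))) :=
    Projective.of_iso (PreservesCoproduct.iso (fiber k c) _).symm inferInstance
  exact (r.map (fiber k c)).projective

lemma hasProjectiveDimensionLT_fiber (c : C) (m : ℕ) (N : RightMod k (Boundary C))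
    (hN : HasProjectiveDimensionLT N m) : HasProjectiveDimensionLT ((fiber k c).obj N) m :=
  hasProjectiveDimensionLT_obj (fiber k c) (fun _ hS => hS.map_of_exact _)
    (projective_fiber c) m N hN

/-- A family of linear maps between the values of two modules over the boundary is a morphism of
modules. -/
def ofFibers {M N : RightMod k (Boundary C)} (φ : ∀ c : C, (fiber k c).obj M ⟶ (fiber k c).obj N) :
    M ⟶ N :=
  RightMod.homMk
    (fun X =>
      { toFun := (φ X.unop.obj).hom
        map_add' := map_add (φ X.unop.obj).hom
        map_smul' := fun r x => by
          have h (M : RightMod k (Boundary C)) (x : M.obj.obj X) :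
              r • x = (MulOpposite.op (r • 𝟙 X.unop.obj : End X.unop.obj) •
                (show (fiber k X.unop.obj).obj M from x)) := by
            have := M.obj.map_smul r (𝟙 X)
            rw [M.obj.map_id] at this
            exact (congr_arg (fun t => t.hom x) this).symm
          rw [h M x]
          exact (map_smul (φ X.unop.obj).hom _ _).trans (h N _).symm })
    (fun {X Y} a x => by
      by_cases h : Y.unop.obj = X.unop.obj
      · obtain ⟨⟨c⟩⟩ := X
        obtain ⟨⟨d⟩⟩ := Y
        dsimp at h
        subst h
        exact map_smul (φ d).hom (MulOpposite.op (α := End d) a.unop.1) x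
      · obtain rfl : a = 0 := Quiver.Hom.unop_inj (hom_eq_zero h a.unop)
        rw [M.obj.map_zero, N.obj.map_zero]
        exact map_zero (φ Y.unop.obj).hom)

lemma ofFibers_app {M N : RightMod k (Boundary C)}
    (φ : ∀ c : C, (fiber k c).obj M ⟶ (fiber k c).obj N) (c : C) (x : M.obj.obj (op ⟨c⟩)) :
    ((ofFibers φ).hom.app (op ⟨c⟩)).hom x = (φ c).hom x := rfl

end BoundaryModules

/-! ### Restriction and coinduction -/

section Restriction

variable {k : Type u} [CommRing k] {C D E : Type u} [Category.{u} C] [Preadditive C] [Linear k C]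
  [Category.{u} D] [Preadditive D] [Linear k D] [Category.{u} E] [Preadditive E] [Linear k E]

namespace RightMod

variable (k) in
/-- Restriction of modules along a linear functor. -/
def restr (F : D ⥤ C) [F.Additive] [F.Linear k] : RightMod k C ⥤ RightMod k D where
  obj M := ⟨F.op ⋙ M.obj,
    ⟨fun {X Y f g} => by
      have : F.map (f + g).unop = _ := F.map_add (f := f.unop) (g := g.unop)
      change M.obj.map (F.map (f + g).unop).op = _
      rw [this]
      exact M.obj.map_add (f := (F.map f.unop).op) (g := (F.map g.unop).op)⟩,
    ⟨fun {X Y} f r => by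
      have : F.map (r • f).unop = _ := F.map_smul r f.unop
      change M.obj.map (F.map (r • f).unop).op = _
      rw [this]
      exact M.obj.map_smul r (F.map f.unop).op⟩⟩
  map f := ObjectProperty.homMk (Functor.whiskerLeft F.op f.hom)

variable (F : D ⥤ C) [F.Additive] [F.Linear k]

instance : (restr k F).Additive where

instance : (restr k F).Linear k where

instance : (restr k F).PreservesMonomorphisms where
  preserves f _ := mono_of_injective _ fun X => injective_of_mono f (F.op.obj X)

/-- Restriction along a composition of functors. -/
def restrComp (G : E ⥤ D) [G.Additive] [G.Linear k] :
    restr k F ⋙ restr k G ≅ restr k (G ⋙ F) := Iso.refl _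

/-- Restriction along the identity functor. -/
def restrId : restr k (𝟭 D) ≅ 𝟭 (RightMod k D) := Iso.refl _

/-- Restrictions along equal functors agree. -/
def restrCongr {F G : D ⥤ C} [F.Additive] [F.Linear k] [G.Additive] [G.Linear k] (h : F = G) :
    restr k F ≅ restr k G :=
  eqToIso (by subst h; rfl)

variable (k) in
/-- Mutually inverse linear functors induce an equivalence of module categories. -/
def restrEquivalence (S : C ⥤ D) (T : D ⥤ C) [S.Additive] [S.Linear k] [T.Additive] [T.Linear k]
    (h : S ⋙ T = 𝟭 C) (h' : T ⋙ S = 𝟭 D) : RightMod k C ≌ RightMod k D :=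
  CategoryTheory.Equivalence.mk (restr k T) (restr k S)
    (restrId.symm ≪≫ restrCongr h.symm ≪≫ (restrComp T S).symm)
    (restrComp S T ≪≫ restrCongr h' ≪≫ restrId)

variable (k) (C) in
/-- The linear Yoneda embedding. -/
def repFunctor : C ⥤ RightMod k C where
  obj c := rep k c
  map f := ObjectProperty.homMk ((linearYoneda k C).map f)
  map_id c := ObjectProperty.hom_ext _ ((linearYoneda k C).map_id c)
  map_comp f g := ObjectProperty.hom_ext _ ((linearYoneda k C).map_comp f g)

instance : (repFunctor k C).Additive where
  map_add {c d f g} := by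
    ext X h
    exact Preadditive.comp_add _ _ _ (show X.unop ⟶ c from h) f g

instance : (repFunctor k C).Linear k where
  map_smul {c d} f r := by
    ext X h
    exact Linear.comp_smul _ _ _ (show X.unop ⟶ c from h) r f

lemma repFunctor_map_comp_repDesc {M : RightMod k C} {c d : C} (f : c ⟶ d) (x : M.obj.obj (op d)) :
    (repFunctor k C).map f ≫ repDesc M x = repDesc M ((M.obj.map f.op).hom x) := by
  have h : (repFunctor k C).map f = repDesc (rep k d) f := rfl
  rw [h]
  exact repDesc_comp (M := rep k d) f (repDesc M x)

lemma repDesc_add (M : RightMod k C) {c : C} (x y : M.obj.obj (op c)) :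
    repDesc M (x + y) = repDesc M x + repDesc M y := by
  ext X f
  exact map_add (M.obj.map (Quiver.Hom.op (X := X.unop) (Y := c) f)).hom x y

lemma repDesc_smul (M : RightMod k C) {c : C} (r : k) (x : M.obj.obj (op c)) :
    repDesc M (r • x) = r • repDesc M x := by
  ext X f
  exact map_smul (M.obj.map (Quiver.Hom.op (X := X.unop) (Y := c) f)).hom r x

/-- Coinduction of modules along a linear functor `F : D ⥤ C`: the value at `c` consists of the
morphisms from the restriction of the module represented by `c`. -/
noncomputable def coind : RightMod k D ⥤ RightMod k C where
  obj N := ⟨(repFunctor k C ⋙ restr k F).op ⋙ (linearYoneda k (RightMod k D)).obj N,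
    ⟨fun {X Y f g} => by
      have := (repFunctor k C ⋙ restr k F).map_add (f := f.unop) (g := g.unop)
      ext h
      exact (congr_arg (· ≫ h) this).trans (Preadditive.add_comp _ _ _ _ _ _)⟩,
    ⟨fun {X Y} f r => by
      have := (repFunctor k C ⋙ restr k F).map_smul r f.unop
      ext h
      exact (congr_arg (· ≫ h) this).trans (Linear.smul_comp _ _ _ _ _ _)⟩⟩
  map f := ObjectProperty.homMk
    (Functor.whiskerLeft _ ((linearYoneda k (RightMod k D)).map f))
  map_id N := ObjectProperty.hom_ext _ (by ext X g; exact Category.comp_id (obj := RightMod k D) g)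
  map_comp f g := ObjectProperty.hom_ext _ (by
    ext X h
    exact (Category.assoc (obj := RightMod k D) h f g).symm)

instance : (coind (k := k) F).Additive where
  map_add {N N' f g} := by
    ext X h
    exact Preadditive.comp_add (C := RightMod k D) _ _ _ h f g

/-- The unit of the adjunction between restriction and coinduction, given by Yoneda's lemma. -/
noncomputable def coindUnit (M : RightMod k C) : M ⟶ (coind F).obj ((restr k F).obj M) :=
  homMk
    (fun X =>
      { toFun := fun x => (restr k F).map (repDesc M (d := X.unop) x)
        map_add' := fun x y => by
          have := repDesc_add M (c := X.unop) x y
          exact (congr_arg (fun t => (restr k F).map t) this).trans (Functor.map_add _)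
        map_smul' := fun r x => by
          have := repDesc_smul M (c := X.unop) r x
          exact (congr_arg (fun t => (restr k F).map t) this).trans (Functor.map_smul _ _ _) })
    (fun {X Y} a x => by
      have := repFunctor_map_comp_repDesc a.unop (M := M) x
      exact (congr_arg (fun t => (restr k F).map t) this.symm).trans (Functor.map_comp _ _ _))

/-- The counit of the adjunction between restriction and coinduction, given by evaluation at
identity morphisms. -/
noncomputable def coindCounit (N : RightMod k D) : (restr k F).obj ((coind F).obj N) ⟶ N :=
  homMk
    (fun X =>
      { toFun := fun g : (restr k F).obj (rep k (F.obj X.unop)) ⟶ N =>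
          (g.hom.app X).hom (𝟙 (F.obj X.unop))
        map_add' := fun _ _ => rfl
        map_smul' := fun _ _ => rfl })
    (fun {X Y} a (g : (restr k F).obj (rep k (F.obj X.unop)) ⟶ N) => by
      have h := naturality g a (𝟙 (F.obj X.unop))
      refine Eq.trans (congr_arg (g.hom.app Y).hom ?_) h
      exact (Category.id_comp (F.map a.unop)).trans (Category.comp_id (F.map a.unop)).symm)

/-- Coinduction is right adjoint to restriction. -/
noncomputable def restrCoindAdjunction : restr k F ⊣ coind F where
  unit :=
    { app := coindUnit F
      naturality := fun M N f => by
        ext X x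
        exact congr_arg (fun t => (restr k F).map t) (repDesc_comp (d := X.unop) x f).symm }
  counit :=
    { app := coindCounit F
      naturality := fun M N f => by
        ext X x
        rfl }
  left_triangle_components M := by
    ext X x
    exact repDesc_id M (d := F.obj X.unop) x
  right_triangle_components N := by
    ext X g
    change (restr k F).obj (rep k X.unop) ⟶ N at g
    have : (restr k F).map (repDesc ((coind F).obj N) (d := X.unop) g) ≫ coindCounit F N = g := by
      ext Y f
      exact congr_arg (g.hom.app Y).hom (Category.id_comp (show F.obj Y.unop ⟶ X.unop from f))
    exact this

/-- Coinduction preserves the coproduct of a family of modules, if the restrictions of all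
representable modules are finitely generated. -/
lemma preservesCoproduct_coind (hF : ∀ c : C, IsFinitelyGenerated ((restr k F).obj (rep k c)))
    {J : Type u} (N : J → RightMod k D) :
    PreservesColimit (Discrete.functor N) (coind F) := by
  classical
  suffices IsIso (sigmaComparison (coind F) N) from PreservesCoproduct.of_iso_comparison _ _
  have hπ (j : J) : sigmaComparison (coind F) N ≫ (coind F).map (Sigma.π N j) =
      Sigma.π (fun j => (coind F).obj (N j)) j := by
    refine Sigma.hom_ext _ _ fun i => ?_
    rw [ι_comp_sigmaComparison_assoc, ← Functor.map_comp, Sigma.ι_π, Sigma.ι_π]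
    split_ifs with h
    · subst h; simp
    · exact Functor.map_zero _ _ _
  -- an inverse of the comparison map on the summands indexed by a finite set
  let σ (s : Finset J) : (coind F).obj (∐ N) ⟶ ∐ fun j => (coind F).obj (N j) :=
    ∑ j ∈ s, (coind F).map (Sigma.π N j) ≫ Sigma.ι (fun j => (coind F).obj (N j)) j
  have h1 (s : Finset J) : sigmaComparison (coind F) N ≫ σ s = finsetProj _ s := by
    simp only [σ, finsetProj, Preadditive.comp_sum, reassoc_of% hπ]
  have h2 (s : Finset J) : σ s ≫ sigmaComparison (coind F) N =
      (coind F).map (finsetProj N s) := by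
    simp only [σ, finsetProj, Preadditive.sum_comp, Category.assoc, ι_comp_sigmaComparison,
      Functor.map_sum, ← Functor.map_comp]
  refine isIso_of_bijective _ fun X => ⟨?_, fun f => ?_⟩
  · rw [injective_iff_map_eq_zero]
    intro z hz
    obtain ⟨s, hs⟩ := exists_finsetProj_app_eq (fun j => (coind F).obj (N j)) z
    have h := congr_arg (fun t => (t.hom.app X).hom z) (h1 s)
    exact hs.symm.trans (h.symm.trans ((congr_arg ((σ s).hom.app X).hom hz).trans (map_zero _)))
  · obtain ⟨s, hs⟩ := (hF X.unop).exists_comp_finsetProj_eq N f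
    exact ⟨((σ s).hom.app X).hom f, (congr_arg (fun t => (t.hom.app X).hom f) (h2 s)).trans hs⟩

end RightMod

end Restriction

/-! ### Restriction to the boundary -/

section RestrictionToBoundary

variable {k : Type u} [CommRing k] {C : Type u} [Category.{u} C] [Preadditive C] [Linear k C]

open Boundary RightMod

variable (C) in
/-- The inclusion of the boundary. -/
def Boundary.incl : Boundary C ⥤ C where
  obj X := X.obj
  map f := f.1

instance : (incl C).Additive where

instance : (incl C).Linear k where

instance : (restr k (incl C)).Faithful where
  map_injective {M N f g} h := by
    ext X x
    exact congr_arg (fun t => (t.hom.app (op (⟨X.unop⟩ : Boundary C))).hom x) h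

/-- The restrictions of the representable modules to the boundary are finitely generated, as the
incoming neighbourhoods are finite and the modules of morphisms are finitely generated. -/
lemma isFinitelyGenerated_restr_rep {c : C} (h : (incoming c).Finite)
    (h' : ∀ d : C, Module.Finite (End d)ᵐᵒᵖ (d ⟶ c)) :
    IsFinitelyGenerated ((restr k (incl C)).obj (rep k c)) := by
  choose G hG using fun d => (h' d).fg_top
  let i (d : C) (g : d ⟶ c) : Σ X : (Boundary C)ᵒᵖ, ((restr k (incl C)).obj (rep k c)).obj.obj X :=
    ⟨op ⟨d⟩, g⟩
  refine ⟨⋃ d ∈ incoming c, i d '' (G d : Set (d ⟶ c)),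
    h.biUnion fun d _ => (G d).finite_toSet.image _, fun N f g hfg => ?_⟩
  have hd (d : C) : (fiber k d).map f = (fiber k d).map g := by
    ext x
    change d ⟶ c at x
    by_cases hd : d ∈ incoming c
    · have hx : x ∈ Submodule.span (End d)ᵐᵒᵖ (G d : Set (d ⟶ c)) := hG d ▸ Submodule.mem_top
      refine Submodule.span_induction
        (p := fun x _ => ((fiber k d).map f).hom x = ((fiber k d).map g).hom x) ?_ ?_ ?_ ?_ hx
      · exact fun y hy => hfg (i d y) (Set.mem_biUnion hd ⟨y, hy, rfl⟩)
      · exact (map_zero ((fiber k d).map f).hom).trans (map_zero ((fiber k d).map g).hom).symm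
      · intro y z _ _ hy hz
        exact (map_add ((fiber k d).map f).hom y z).trans
          ((congr_arg₂ _ hy hz).trans (map_add ((fiber k d).map g).hom y z).symm)
      · intro a y _ hy
        exact (map_smul ((fiber k d).map f).hom a y).trans
          ((congr_arg (a • ·) hy).trans (map_smul ((fiber k d).map g).hom a y).symm)
    · obtain rfl : x = 0 := by
        by_contra hx
        exact hd ⟨x, hx⟩
      exact (map_zero ((fiber k d).map f).hom).trans (map_zero ((fiber k d).map g).hom).symm
  ext X x
  exact congr_arg (fun t => t.hom x) (hd X.unop.obj)

/-- Coinduction from the boundary sends epimorphisms between modules of finite projective dimension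
to epimorphisms, since the modules of morphisms are Gorenstein projective. -/
lemma epi_coind_map (h : ∀ c d : C, IsGorensteinProjective (ModuleCat.of (End d)ᵐᵒᵖ (d ⟶ c)))
    {M N : RightMod k (Boundary C)} (p : M ⟶ N) [Epi p] (m : ℕ)
    (hM : HasProjectiveDimensionLT M m) (hN : HasProjectiveDimensionLT N m) :
    Epi ((coind (incl C)).map p) := by
  rw [epi_iff]
  intro X f
  change (restr k (incl C)).obj (rep k X.unop) ⟶ N at f
  choose g hg using fun d => (h X.unop d).exists_lift ((fiber k d).map p) m
    (hasProjectiveDimensionLT_fiber d m M hM) (hasProjectiveDimensionLT_fiber d m N hN)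
    ((fiber k d).map f)
  let g' : (restr k (incl C)).obj (rep k X.unop) ⟶ M := ofFibers g
  have : g' ≫ p = f := by
    ext Y x
    exact congr_arg (fun t => t.hom x) (hg Y.unop.obj)
  exact ⟨g', this⟩

open Classical in
/-- The morphism of modules over the boundary which is given by a linear map at one object, and
which vanishes at all other objects. -/
noncomputable def ofFiber {M N : RightMod k (Boundary C)} (d : C)
    (φ : (fiber k d).obj M ⟶ (fiber k d).obj N) : M ⟶ N :=
  ofFibers (Function.update (fun _ => 0) d φ)

lemma ofFiber_app_self {M N : RightMod k (Boundary C)} (d : C)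
    (φ : (fiber k d).obj M ⟶ (fiber k d).obj N) (x : M.obj.obj (op ⟨d⟩)) :
    ((ofFiber d φ).hom.app (op ⟨d⟩)).hom x = φ.hom x :=
  (ofFibers_app _ d x).trans (by classical rw [Function.update_self])

lemma ofFiber_app_of_ne {M N : RightMod k (Boundary C)} (d : C)
    (φ : (fiber k d).obj M ⟶ (fiber k d).obj N) {c : C} (h : c ≠ d) (x : M.obj.obj (op ⟨c⟩)) :
    ((ofFiber d φ).hom.app (op ⟨c⟩)).hom x = 0 :=
  (ofFibers_app _ c x).trans (by classical rw [Function.update_of_ne h]; rfl)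

variable (k) in
/-- Endomorphisms of `d`, as the value at `d` of a module over the boundary. -/
def endFiber (d : C) : ModuleCat.of (End d)ᵐᵒᵖ (End d) ⟶ (fiber k d).obj (rep k ⟨d⟩) :=
  ModuleCat.ofHom
    { toFun := ofEnd
      map_add' := fun _ _ => rfl
      map_smul' := fun _ _ => rfl }

variable (k) in
/-- The projection of the restriction of a representable module of `C` onto the corresponding
representable module of the boundary, which forgets all morphisms between distinct objects. -/
noncomputable def repProj (d : C) : (restr k (incl C)).obj (rep k d) ⟶ rep k ⟨d⟩ :=
  ofFiber d (endFiber k d)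

lemma repProj_app_self {d : C} (f : d ⟶ d) :
    ((repProj k d).hom.app (op ⟨d⟩)).hom f = ofEnd f :=
  ofFiber_app_self (M := (restr k (incl C)).obj (rep k d)) d (endFiber k d) f

lemma repProj_app_of_ne {c d : C} (h : c ≠ d) (f : c ⟶ d) :
    ((repProj k d).hom.app (op ⟨c⟩)).hom f = 0 :=
  ofFiber_app_of_ne (M := (restr k (incl C)).obj (rep k d)) d (endFiber k d) h f

lemma repProj_naturality {X Y : Boundary C} (a : Y ⟶ X) :
    repProj k Y.obj ≫ (repFunctor k (Boundary C)).map a =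
      (restr k (incl C)).map ((repFunctor k C).map a.1) ≫ repProj k X.obj := by
  obtain ⟨x⟩ := X
  obtain ⟨y⟩ := Y
  by_cases hxy : y = x
  · subst hxy
    ext ⟨⟨c⟩⟩ f
    by_cases hc : c = y
    · subst hc
      refine (congr_arg (((repFunctor k (Boundary C)).map a).hom.app _).hom
        (repProj_app_self f)).trans (Eq.trans ?_ (repProj_app_self (f ≫ a.1)).symm)
      rfl
    · refine (congr_arg (((repFunctor k (Boundary C)).map a).hom.app _).hom
        (repProj_app_of_ne hc f)).trans
        ((map_zero _).trans (repProj_app_of_ne hc (f ≫ a.1)).symm)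
  · obtain rfl := hom_eq_zero hxy a
    have h : (repFunctor k C).map ((0 : (⟨y⟩ : Boundary C) ⟶ ⟨x⟩).1) = 0 :=
      (repFunctor k C).map_zero y x
    rw [h, Functor.map_zero, Functor.map_zero]
    exact comp_zero.trans zero_comp.symm

/-- Every module `N` over the boundary embeds naturally into the restriction of its coinduction. -/
noncomputable def coindSection :
    𝟭 (RightMod k (Boundary C)) ⟶ coind (incl C) ⋙ restr k (incl C) where
  app N := homMk
    (fun X =>
      { toFun := fun x => repProj k X.unop.obj ≫ repDesc N (d := X.unop) x
        map_add' := fun x y =>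
          (congr_arg (repProj k X.unop.obj ≫ ·) (repDesc_add N (c := X.unop) x y)).trans
            (Preadditive.comp_add _ _ _ _ _ _)
        map_smul' := fun r x =>
          (congr_arg (repProj k X.unop.obj ≫ ·) (repDesc_smul N (c := X.unop) r x)).trans
            (Linear.comp_smul _ _ _ _ _ _) })
    (fun {X Y} a x => by
      have h := repFunctor_map_comp_repDesc a.unop (M := N) x
      have h' := repProj_naturality (k := k) a.unop
      refine (congr_arg (repProj k Y.unop.obj ≫ ·) h.symm).trans ?_
      exact (Category.assoc _ _ _).symm.trans
        ((congr_arg (· ≫ repDesc N (d := X.unop) x) h').trans (Category.assoc _ _ _)))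
  naturality M N f := by
    ext X x
    refine (congr_arg (repProj k X.unop.obj ≫ ·) (repDesc_comp (d := X.unop) x f).symm).trans ?_
    exact (Category.assoc _ _ _).symm

lemma coindSection_comp_counit :
    coindSection ≫ (restrCoindAdjunction (k := k) (incl C)).counit = 𝟙 _ := by
  ext N : 2
  ext X x
  have h : ((repProj k X.unop.obj).hom.app X).hom (𝟙 X.unop.obj) = 𝟙 X.unop :=
    repProj_app_self _
  exact (congr_arg ((repDesc N (d := X.unop) x).hom.app X).hom h).trans (repDesc_id N _)

/-- The duality isomorphisms identify the representable module of `d` with the coinduction of the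
representable module of `d` over the boundary, twisted by `S`: the isomorphism corresponds to
`ψ (𝟙 d)` by Yoneda's lemma. -/
lemma nonempty_rep_iso {S : C ⥤ C} [S.Additive] [S.Linear k] (B : BoundaryDuality S) (d : C) :
    Nonempty (rep k d ≅ (restr k S).obj ((coind (incl C)).obj (rep k ⟨d⟩))) := by
  let u : (restr k (incl C)).obj (rep k (S.obj d)) ⟶ rep k ⟨d⟩ :=
    ofFiber d (ModuleCat.ofHom (X := (d ⟶ S.obj d)) (B.ψ d d (𝟙 d)) ≫ endFiber k d)
  let Φ : rep k d ⟶ (restr k S).obj ((coind (incl C)).obj (rep k ⟨d⟩)) :=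
    repDesc ((restr k S).obj ((coind (incl C)).obj (rep k ⟨d⟩))) (d := d) u
  let Φ' (c : C) (f : c ⟶ d) : (restr k (incl C)).obj (rep k (S.obj c)) ⟶ rep k ⟨d⟩ :=
    (Φ.hom.app (op c)).hom f
  have hΦ (c : C) (f : c ⟶ d) (g : d ⟶ S.obj c) :
      ((Φ' c f).hom.app (op ⟨d⟩)).hom g = ofEnd (B.ψ c d f g) := by
    refine (ofFiber_app_self (M := (restr k (incl C)).obj (rep k (S.obj d))) d _
      (g ≫ S.map f)).trans ?_
    have := B.natural d f (𝟙 d) g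
    rw [Category.comp_id] at this
    exact congr_arg ofEnd this.symm
  suffices IsIso Φ from ⟨asIso Φ⟩
  refine isIso_of_bijective _ fun X => ⟨fun f f' hf => ?_, fun h => ?_⟩
  · change X.unop ⟶ d at f f'
    change Φ' X.unop f = Φ' X.unop f' at hf
    refine (B.ψ X.unop d).injective (LinearMap.ext fun g => ?_)
    have h := hΦ X.unop f g
    rw [hf, hΦ] at h
    exact (congr_arg Subtype.val h).symm
  · change (restr k (incl C)).obj (rep k (S.obj X.unop)) ⟶ rep k ⟨d⟩ at h
    let v : (d ⟶ S.obj X.unop) →ₗ[(End d)ᵐᵒᵖ] End d :=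
      { toFun := fun g => ((h.hom.app (op ⟨d⟩)).hom g : (⟨d⟩ : Boundary C) ⟶ ⟨d⟩).1
        map_add' := fun g g' => congr_arg Subtype.val (map_add (h.hom.app (op ⟨d⟩)).hom g g')
        map_smul' := fun a g => congr_arg Subtype.val (naturality h (ofEnd a.unop).op g) }
    obtain ⟨f, hf⟩ := (B.ψ X.unop d).surjective v
    refine ⟨f, ?_⟩
    change Φ' X.unop f = h
    ext ⟨⟨c⟩⟩ g
    by_cases hc : c = d
    · subst hc
      refine (hΦ _ _ _).trans ?_
      rw [hf]
      rfl
    · exact (subsingleton_rep_of_ne (k := k) (X := ⟨d⟩) hc).elim _ _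

end RestrictionToBoundary

end GorensteinCat

open GorensteinCat in
theorem theorem5p4 (k : Type u) [CommRing k] (C : Type u) [Category.{u} C] [Preadditive C]
    [Linear k C]
    -- the boundary is Gorenstein
    (h1 : IsGorensteinCategory (RightMod k (Boundary C)))
    (h2 : IsLocallyBounded C)
    -- an automorphism restricting to isomorphisms between the full subcategories
    -- given by the incoming and by the outgoing neighbourhood of every object
    (S : C ⥤ C) [S.Additive] [S.Linear k] (h3 : IsAutomorphism S)
    (h3' : ∀ c : C, Set.BijOn S.obj (incoming c) (outgoing c))
    (h4 : Nonempty (BoundaryDuality S))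
    (h5 : ∀ c d : C, Module.Finite (End c)ᵐᵒᵖ (c ⟶ d) ∧
      IsGorensteinProjective (ModuleCat.of (End c)ᵐᵒᵖ (c ⟶ d))) :
    -- the Gorenstein dimension `n` of the boundary is also that of the category itself
    ∃ n : ℕ, IsGorensteinCategoryOfDim (RightMod k (Boundary C)) n ∧
      IsGorensteinCategoryOfDim (RightMod k C) n := by
  obtain ⟨T, hST, hTS⟩ := h3
  obtain ⟨B⟩ := h4
  let e₀ : C ≌ C := CategoryTheory.Equivalence.mk S T (eqToIso hST.symm) (eqToIso hTS)
  have : e₀.functor.Additive := inferInstanceAs S.Additive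
  have : e₀.functor.Linear k := inferInstanceAs (S.Linear k)
  have : T.Additive := inferInstanceAs e₀.inverse.Additive
  have : T.Linear k := inferInstanceAs (e₀.inverse.Linear k)
  let e := RightMod.restrEquivalence k S T hST hTS
  let L := RightMod.restr k (Boundary.incl C)
  let R : RightMod k (Boundary C) ⥤ RightMod k C := RightMod.coind (Boundary.incl C)
  have adj : L ⊣ R := RightMod.restrCoindAdjunction (Boundary.incl C)
  let κ : (R ⋙ e.inverse) ⋙ e.functor ⋙ L ≅ R ⋙ L :=
    Functor.isoWhiskerLeft R (Functor.isoWhiskerRight e.counitIso L)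
  -- the twisted coinduction of a free module over the boundary is a free module
  have hfree {J : Type u} (d : J → C) :
      Nonempty ((R ⋙ e.inverse).obj (∐ fun j => RightMod.rep k ⟨d j⟩) ≅
        ∐ fun j => RightMod.rep k (d j)) := by
    have : PreservesColimit (Discrete.functor fun j => RightMod.rep k ⟨d j⟩) R :=
      RightMod.preservesCoproduct_coind _ (fun c => isFinitelyGenerated_restr_rep (h2 c).1
        fun d => (h5 d c).1) _
    exact ⟨PreservesCoproduct.iso (R ⋙ e.inverse) _ ≪≫
      Sigma.mapIso fun j => (nonempty_rep_iso B (d j)).some.symm⟩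
  refine exists_isGorensteinCategoryOfDim_of_adjunction (e.toAdjunction.comp adj) h1
    (fun p _ m hX hY => ?_) (fun Q hQ => ?_) (fun P hP => ?_)
    (coindSection ≫ κ.inv) (κ.hom ≫ (RightMod.restrCoindAdjunction (Boundary.incl C)).counit) ?_
    RightMod.isGrothendieckAbelian ⟨_, RightMod.isSeparator_coproduct_rep, inferInstance⟩
  · have : Epi (R.map p) := epi_coind_map (fun c d => (h5 d c).2) p m hX hY
    exact inferInstanceAs (Epi (e.inverse.map (R.map p)))
  · obtain ⟨J, d, ⟨r⟩⟩ := RightMod.exists_retract_coproduct_rep Q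
    obtain ⟨i⟩ := hfree fun j => (d j).obj
    exact ((r.map (R ⋙ e.inverse)).trans (Retract.ofIso i)).projective
  · obtain ⟨J, d, ⟨r⟩⟩ := RightMod.exists_retract_coproduct_rep P
    obtain ⟨i⟩ := hfree d
    exact ⟨_, inferInstance, ⟨r.trans (Retract.ofIso i.symm)⟩⟩
  · rw [Category.assoc, κ.inv_hom_id_assoc, coindSection_comp_counit]
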